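/- Let $\dot W$ be a space-time white noise on $[0,\infty)\times[0,1]$ with respect to a filtration $(\mathcal F_t)_{t\ge0}$ on a probability space $(\Omega,\mathcal F,\mathbf P)$, let $\sigma>0$, let $b:\mathbf R\to[0,\infty)$ be locally Lipschitz on $\mathbf R$ and nondecreasing on $(0,\infty)$, and let $u_0:[0,1]\to[0,\infty)$ be continuous. Consider $$\partial_t u(t,x)=\partial_x^2 u(t,x)+b(u(t,x))+\sigma\dot W(t,x),\qquad x\in[0,1],\ t>0,\qquad u(0,x)=u_0(x),$$ with homogeneous Dirichlet boundary conditions. Let $p(t,x,y)=\sum_{n\ge1}2\sin(n\pi x)\sin(n\pi y)e^{-n^2\pi^2t}$ be the Dirichlet heat kernel. For each integer $N\ge1$ let $b_N(x)=b(x)$ for $|x|\le N$, $b_N(x)=b(N)$ for $x>N$, $b_N(x)=b(-N)$ for $x<-N$, and let $u_N$ be the global random field solution of the equation with $b$ replaced by $b_N$, that is, the jointly measurable and adapted process on $[0,\infty)\times[0,1]$, almost surely continuous on $(0,\infty)\times[0,1]$, such that for every $t>0$ and $x\in[0,1]$, almost surely, $$u_N(t,x)=\int_0^1p(t,x,y)u_0(y)\,dy+\int_0^t\!\int_0^1p(t-s,x,y)\,b_N(u_N(s,y))\,dy\,ds+\sigma\int_0^t\!\int_0^1p(t-s,x,y)\,W(dy\,ds).$$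 Put $\tau_N=\inf\{t>0:\sup_{x\in[0,1]}|u_N(t,x)|>N\}$ (with $\inf\emptyset=\infty$) and let $\tau_\infty=\sup_{N\ge1}\tau_N$, which is almost surely the limit of the $\tau_N$ as $N\to\infty$. (The local solution of the original equation equals $u_N$ on $[0,\tau_N)$, and $\tau_\infty$ is its blow-up time.) If the solution blows up in finite time with positive probability, i.e. if $\mathbf P(\tau_\infty<\infty)>0$, then $b$ satisfies the Osgood condition: for some $a>0$, $$\int_a^\infty\frac{ds}{b(s)}<\infty,\qquad\text{where }1/0=\infty.$$ -/

import Mathlib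

open MeasureTheory ProbabilityTheory Filter Set
open scoped NNReal ENNReal Topology

noncomputable section

namespace OsgoodSPDE

/-- Space-time `[0, ∞) × [0, 1]`. -/
abbrev SpaceTime : Type := ℝ≥0 × unitInterval

/-- Lebesgue measure on `[0, ∞) × [0, 1]`. -/
def leb : Measure SpaceTime :=
  (Measure.comap (fun t : ℝ≥0 => (t : ℝ)) volume).prod volume

/-- The heat kernel of `Δ = d²/dx²` on `[0, 1]` with Dirichlet boundary conditions, for `t > 0`:
`p(t, x, y) = ∑_{n ≥ 1} 2 sin(nπx) sin(nπy) exp(-n²π²t)`. -/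
def dirichletHeatKernel (t x y : ℝ) : ℝ :=
  ∑' n : ℕ, 2 * Real.sin ((n + 1 : ℝ) * Real.pi * x) * Real.sin ((n + 1 : ℝ) * Real.pi * y) *
    Real.exp (-((n + 1 : ℝ) ^ 2 * Real.pi ^ 2 * t))

/-- The function `(s, y) ↦ 1_{s < t} p(t - s, x, y)` on space-time. -/
def shiftedKernel (t : ℝ≥0) (x : unitInterval) : SpaceTime → ℝ :=
  Set.indicator (Set.Iio t ×ˢ Set.univ)
    (fun z => dirichletHeatKernel ((t : ℝ) - (z.1 : ℝ)) (x : ℝ) (z.2 : ℝ))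

variable {Ω : Type*} {mΩ : MeasurableSpace Ω}

/-- `W` is a space-time white noise on `[0, ∞) × [0, 1]` with respect to the filtration `ℱ`:
a centred Gaussian family indexed by the Borel sets `A` of finite measure, with
`E[W(A) W(B)] = |A ∩ B|`, such that `W(A)` is `ℱ_t`-measurable for `A ⊆ [0, t] × [0, 1]` and
the family of all `W(A)` with `A ⊆ (t, ∞) × [0, 1]` is independent of `ℱ_t`.
The values of `W` on other sets play no role. -/
structure IsWhiteNoise (P : Measure Ω) (ℱ : Filtration ℝ≥0 mΩ) (W : Set SpaceTime → Ω → ℝ) :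
    Prop where
  measurable : ∀ A, MeasurableSet A → leb A ≠ ∞ → Measurable (W A)
  gaussian : IsGaussianProcess
    (fun A : {A : Set SpaceTime // MeasurableSet A ∧ leb A ≠ ∞} => W A.1) P
  mean_zero : ∀ A, MeasurableSet A → leb A ≠ ∞ → ∫ ω, W A ω ∂P = 0
  covariance : ∀ A B, MeasurableSet A → leb A ≠ ∞ → MeasurableSet B → leb B ≠ ∞ →
    ∫ ω, W A ω * W B ω ∂P = (leb (A ∩ B)).toReal
  adapted : ∀ (t : ℝ≥0) (A : Set SpaceTime), MeasurableSet A → leb A ≠ ∞ →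
    A ⊆ Set.Iic t ×ˢ Set.univ → Measurable[ℱ t] (W A)
  indep : ∀ t : ℝ≥0, Indep
    (⨆ A : {A : Set SpaceTime // MeasurableSet A ∧ leb A ≠ ∞ ∧ A ⊆ Set.Ioi t ×ˢ Set.univ},
      MeasurableSpace.comap (W A.1) inferInstance) (ℱ t) P

/-- The integral of a simple function `∑ c 1_{f = c}` against `W`. -/
def simpleWienerIntegral (W : Set SpaceTime → Ω → ℝ) (f : SimpleFunc SpaceTime ℝ) (ω : Ω) : ℝ :=
  ∑ c ∈ f.range, c * W (f ⁻¹' {c}) ω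

/-- `X` is (a version of) the Wiener integral `∫ h dW` of `h ∈ L²([0, ∞) × [0, 1])`: the
`L²(P)`-limit of the integrals of square integrable simple functions converging to `h` in `L²`. -/
def HasWienerIntegral (P : Measure Ω) (W : Set SpaceTime → Ω → ℝ) (h : SpaceTime → ℝ)
    (X : Ω → ℝ) : Prop :=
  MemLp h 2 leb ∧ MemLp X 2 P ∧
    ∃ f : ℕ → SimpleFunc SpaceTime ℝ,
      (∀ n, MemLp (f n) 2 leb) ∧
      Tendsto (fun n => eLpNorm (fun z => f n z - h z) 2 leb) atTop (𝓝 0) ∧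
      Tendsto (fun n => eLpNorm (fun ω => simpleWienerIntegral W (f n) ω - X ω) 2 P)
        atTop (𝓝 0)

/-- `u` is a global random field (mild) solution, with almost surely continuous paths on
`(0, ∞) × [0, 1]`, of `∂ₜu = Δu + g(u) + σẆ` on `[0, 1]` with homogeneous Dirichlet boundary
conditions and initial condition `u₀`. (Continuity is not required at time `0`, since `u₀` need
not vanish at the boundary points.) -/
structure IsGlobalSolution (P : Measure Ω) (ℱ : Filtration ℝ≥0 mΩ) (W : Set SpaceTime → Ω → ℝ)
    (g : ℝ → ℝ) (σ : ℝ) (u₀ : unitInterval → ℝ) (u : ℝ≥0 → unitInterval → Ω → ℝ) : Prop where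
  jointlyMeasurable : Measurable (fun q : (ℝ≥0 × unitInterval) × Ω => u q.1.1 q.1.2 q.2)
  adapted : ∀ t x, Measurable[ℱ t] (u t x)
  mild : ∀ (t : ℝ≥0) (x : unitInterval), 0 < t → ∃ X : Ω → ℝ,
    HasWienerIntegral P W (shiftedKernel t x) X ∧
    ∀ᵐ ω ∂P,
      Integrable (fun z : SpaceTime => shiftedKernel t x z * g (u z.1 z.2 ω)) leb ∧
      u t x ω = (∫ y : unitInterval, dirichletHeatKernel t x y * u₀ y)
        + (∫ z : SpaceTime, shiftedKernel t x z * g (u z.1 z.2 ω) ∂leb)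
        + σ * X ω
  continuous : ∀ᵐ ω ∂P,
    ContinuousOn (fun z : SpaceTime => u z.1 z.2 ω) (Set.Ioi 0 ×ˢ Set.univ)

/-- The truncation `b_N` of `b`: it is `b(x)` for `|x| ≤ N`, `b(N)` for `x > N` and `b(-N)` for
`x < -N`. -/
def truncateDrift (b : ℝ → ℝ) (N : ℕ) (x : ℝ) : ℝ :=
  if |x| ≤ N then b x else if (N : ℝ) < x then b N else b (-N)

/-- `τ_N = inf {t > 0 : sup_{x ∈ [0, 1]} |v(t, x)| > N}`, with `inf ∅ = ∞`. -/
def exitTime (v : ℝ≥0 → unitInterval → Ω → ℝ) (N : ℕ) (ω : Ω) : ℝ≥0∞ :=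
  ⨅ (t : ℝ≥0) (_ : 0 < t ∧ (N : ℝ≥0∞) < ⨆ x : unitInterval, ‖v t x ω‖ₑ), (t : ℝ≥0∞)

/-- The blow-up time `τ_∞`, the monotone limit of the exit times `τ_N`, `N ≥ 1`, where `u N` is
the solution of the equation with drift `b_N`. -/
def blowupTime (u : ℕ → ℝ≥0 → unitInterval → Ω → ℝ) (ω : Ω) : ℝ≥0∞ :=
  ⨆ (N : ℕ) (_ : 1 ≤ N), exitTime (u N) N ω

/-- The Osgood condition: `∫_a^∞ ds / b(s) < ∞` for some `a > 0`, where `1/0 = ∞`. -/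
def OsgoodCondition (b : ℝ → ℝ) : Prop :=
  ∃ a : ℝ, 0 < a ∧ ∫⁻ s in Set.Ioi a, (ENNReal.ofReal (b s))⁻¹ < ∞

end OsgoodSPDE

end

/-!
Suppose that the Osgood condition fails and fix `T > 0`. The bounds below do not depend on `N`.

* The kernel satisfies `p ≥ 0` and `∫ p(t, x, y) dy ≤ 1`. By Jacobi's triple product,
  `θ(w) = 1 + 2 ∑ exp(-n²π²t) cos(nw)` is a limit of products of factors that are nonnegative and
  increase with `cos w`, and `p(t, x, y) = (θ(π(x - y)) - θ(π(x + y))) / 2`, while `θ` has mean `1`.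
* The stochastic convolution is bounded on `(0, T) × [0, 1]`. Since the drift of `u₁` is bounded,
  the equation for the continuous path `u₁` bounds it at times in `[1, T + 1]`. Flipping the sign
  of the noise after time `1` does not change its law, so the contribution of that noise is bounded
  on its own, and it has the law of the stochastic convolution shifted in time by `1`.
* Hence almost surely there are `A` and a continuous increasing `B`, equal to `b` up to a constant
  on `[0, ∞)`, such that `φ(s) = sup_x u_N(s, x)` satisfies `φ(t) ≤ A + ∫_0^t B(φ(s)) ds` for
  `t < T`. As `∫^∞ dv / B(v) = ∞`, this bounds `φ` on `(0, T)` by a `K`, and choosing `N ≥ K` shows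
  that `u_N` has not left `[-N, N]` before time `T`.
-/

namespace OsgoodSPDE

/-- The coefficients of the Laurent polynomial
`∏_{j < m} (1 + q^(2j+1) z) (1 + q^(2j+1) z⁻¹)`, a partial product of Jacobi's triple product. -/
noncomputable def jacobiCoeff (q : ℝ) : ℕ → ℤ → ℝ
  | 0 => Pi.single 0 1
  | m + 1 => fun k => (1 + q ^ (4 * m + 2)) * jacobiCoeff q m k +
      q ^ (2 * m + 1) * (jacobiCoeff q m (k - 1) + jacobiCoeff q m (k + 1))

/-- The Laurent polynomial with coefficients `jacobiCoeff q m`, at `z = exp (i w)`. -/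
noncomputable def jacobiProd (q w : ℝ) (m : ℕ) : ℝ :=
  ∏ j ∈ Finset.range m, (1 + q ^ (4 * j + 2) + q ^ (2 * j + 1) * (2 * Real.cos w))

/-- The theta function `∑_{k ∈ ℤ} q^{k²} cos (k w)`. -/
noncomputable def thetaCos (q w : ℝ) : ℝ := ∑' k : ℤ, q ^ (k.natAbs ^ 2) * Real.cos (k * w)

section Theta

lemma jacobiCoeff_succ (q : ℝ) (m : ℕ) (k : ℤ) :
    jacobiCoeff q (m + 1) k = (1 + q ^ (4 * m + 2)) * jacobiCoeff q m k +
      q ^ (2 * m + 1) * (jacobiCoeff q m (k - 1) + jacobiCoeff q m (k + 1)) :=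
  rfl

lemma jacobiCoeff_neg (q : ℝ) (m : ℕ) (k : ℤ) : jacobiCoeff q m (-k) = jacobiCoeff q m k := by
  induction m generalizing k with
  | zero => simp [jacobiCoeff, Pi.single_apply]
  | succ m ih =>
    rw [jacobiCoeff_succ, jacobiCoeff_succ, ih, show -k - 1 = -(k + 1) by ring, ih,
      show -k + 1 = -(k - 1) by ring, ih, add_comm (jacobiCoeff q m (k + 1))]

lemma jacobiCoeff_natAbs (q : ℝ) (m : ℕ) (k : ℤ) :
    jacobiCoeff q m k.natAbs = jacobiCoeff q m k := by
  rcases k.natAbs_eq with hk | hk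
  · rw [← hk]
  · conv_rhs => rw [hk, jacobiCoeff_neg]

lemma jacobiCoeff_nonneg {q : ℝ} (hq : 0 ≤ q) (m : ℕ) (k : ℤ) : 0 ≤ jacobiCoeff q m k := by
  induction m generalizing k with
  | zero => exact Pi.single_nonneg (α := fun _ : ℤ => ℝ).2 zero_le_one k
  | succ m ih =>
    have := ih k
    have := ih (k - 1)
    have := ih (k + 1)
    rw [jacobiCoeff_succ]
    positivity

lemma jacobiCoeff_zero_pos {q : ℝ} (hq : 0 ≤ q) (m : ℕ) : 0 < jacobiCoeff q m 0 := by
  induction m with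
  | zero => simp [jacobiCoeff]
  | succ m ih =>
    have := jacobiCoeff_nonneg hq m (0 - 1)
    have := jacobiCoeff_nonneg hq m (0 + 1)
    rw [jacobiCoeff_succ]
    positivity

lemma hasSum_jacobiCoeff_mul_zpow (q : ℝ) {z : ℂ} (hz : z ≠ 0) (m : ℕ) :
    HasSum (fun k : ℤ => (jacobiCoeff q m k : ℂ) * z ^ k)
      (∏ j ∈ Finset.range m, (1 + (q : ℂ) ^ (4 * j + 2) + q ^ (2 * j + 1) * (z + z⁻¹))) := by
  induction m with
  | zero =>
    have off_zero (k : ℤ) (hk : k ≠ 0) : (jacobiCoeff q 0 k : ℂ) * z ^ k = 0 := by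
      simp [jacobiCoeff, hk]
    simpa [jacobiCoeff] using hasSum_single (0 : ℤ) off_zero
  | succ m ih =>
    rw [Finset.prod_range_succ]
    set S := ∏ j ∈ Finset.range m, (1 + (q : ℂ) ^ (4 * j + 2) + q ^ (2 * j + 1) * (z + z⁻¹))
    have shift_left : HasSum (fun k : ℤ => (jacobiCoeff q m (k - 1) : ℂ) * z ^ k) (S * z) := by
      convert! ((Equiv.subRight (1 : ℤ)).hasSum_iff.2 ih).mul_right z using 2 with k
      simp only [Function.comp, Equiv.subRight_apply]
      rw [mul_assoc, ← zpow_add_one₀ hz, sub_add_cancel]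
    have shift_right :
        HasSum (fun k : ℤ => (jacobiCoeff q m (k + 1) : ℂ) * z ^ k) (S * z⁻¹) := by
      convert! ((Equiv.addRight (1 : ℤ)).hasSum_iff.2 ih).mul_right z⁻¹ using 2 with k
      simp only [Function.comp, Equiv.coe_addRight]
      rw [mul_assoc, ← zpow_sub_one₀ hz, add_sub_cancel_right]
    convert! (ih.mul_left (1 + (q : ℂ) ^ (4 * m + 2))).add
      ((shift_left.add shift_right).mul_left ((q : ℂ) ^ (2 * m + 1))) using 1
    · funext k; rw [jacobiCoeff_succ]; push_cast; ring
    · ring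

lemma hasSum_jacobiCoeff_mul_cos (q w : ℝ) (m : ℕ) :
    HasSum (fun k : ℤ => jacobiCoeff q m k * Real.cos (k * w)) (jacobiProd q w m) := by
  convert! Complex.hasSum_re
    (hasSum_jacobiCoeff_mul_zpow q (Complex.exp_ne_zero (w * Complex.I)) m) using 1
  · funext k
    rw [← Complex.exp_int_mul, ← mul_assoc, Complex.re_ofReal_mul,
      show (k : ℂ) * w = ((k * w : ℝ) : ℂ) by push_cast; rfl, Complex.exp_ofReal_mul_I_re]
  · rw [jacobiProd, ← Complex.ofReal_re (∏ j ∈ Finset.range m, _)]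
    push_cast
    simp_rw [Complex.two_cos, neg_mul, Complex.exp_neg]

/-- The coefficient form of `(q z + q^(2m)) L(q² z) = (1 + q^(2m+1) z) L(z)`, where `L` is the
Laurent polynomial with coefficients `jacobiCoeff q m`. -/
lemma jacobiCoeff_recursion {q : ℝ} (hq : q ≠ 0) (m : ℕ) (k : ℤ) :
    (1 - q ^ (2 * m) * q ^ (2 * (k + 1))) * jacobiCoeff q m (k + 1) =
      (q * q ^ (2 * k) - q * q ^ (2 * m)) * jacobiCoeff q m k := by
  have shift_up (k : ℤ) : q ^ (2 * (k + 1)) = q ^ (2 * k) * q ^ 2 := by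
    rw [mul_add, zpow_add₀ hq]
    norm_cast
  induction m generalizing k with
  | zero =>
    by_cases h0 : k = 0
    · subst h0; simp [jacobiCoeff]
    by_cases h1 : k = -1
    · subst h1; simp [jacobiCoeff]
    simp [jacobiCoeff, h0, show k + 1 ≠ 0 by omega]
  | succ m ih =>
    have ih_mid := ih k
    have ih_up := ih (k + 1)
    have ih_down := ih (k - 1)
    have shift_mid := shift_up k
    have shift_down := shift_up (k - 1)
    rw [sub_add_cancel] at ih_down shift_down
    rw [shift_up (k + 1), shift_mid, shift_down] at ih_up
    rw [shift_mid, shift_down] at ih_mid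
    rw [shift_down] at ih_down
    rw [jacobiCoeff_succ, jacobiCoeff_succ, shift_mid, shift_down, add_sub_cancel_right,
      show 2 * (m + 1) = 2 * m + 2 by ring, show 4 * m + 2 = 2 * m + 2 * m + 2 by ring]
    simp only [pow_add, pow_one]
    linear_combination (1 + q ^ 4 * (q ^ (2 * m)) ^ 2) * ih_mid + q * q ^ (2 * m) * ih_up +
      q ^ 3 * q ^ (2 * m) * ih_down

lemma jacobiCoeff_recursion_nat {q : ℝ} (hq : q ≠ 0) (m k : ℕ) :
    (1 - q ^ (2 * m + 2 * k + 2)) * jacobiCoeff q m (k + 1 : ℕ) =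
      (q ^ (2 * k + 1) - q ^ (2 * m + 1)) * jacobiCoeff q m k := by
  convert! jacobiCoeff_recursion hq m k using 2
  · rw [show 2 * ((k : ℤ) + 1) = (2 * k + 2 : ℕ) by push_cast; ring, zpow_natCast]
    ring
  · rw [show 2 * (k : ℤ) = (2 * k : ℕ) by push_cast; rfl, zpow_natCast]
    ring

lemma jacobiCoeff_natCast_le {q : ℝ} (h0 : 0 < q) (h1 : q < 1) (m k : ℕ) :
    jacobiCoeff q m k ≤ q ^ (k ^ 2) * jacobiCoeff q m 0 := by
  induction k with
  | zero => simp
  | succ k ih =>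
    have hden : 0 < 1 - q ^ (2 * m + 2 * k + 2) := sub_pos.2 (pow_lt_one₀ h0.le h1 (by omega))
    have hratio : q ^ (2 * k + 1) - q ^ (2 * m + 1) ≤
        (1 - q ^ (2 * m + 2 * k + 2)) * q ^ (2 * k + 1) := by
      have : q ^ (2 * m + 2 * k + 2 + (2 * k + 1)) ≤ q ^ (2 * m + 1) :=
        pow_le_pow_of_le_one h0.le h1.le (by omega)
      rw [sub_mul, one_mul, ← pow_add]
      linarith
    have hstep : jacobiCoeff q m (k + 1 : ℕ) ≤ q ^ (2 * k + 1) * jacobiCoeff q m k := by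
      refine le_of_mul_le_mul_left ?_ hden
      rw [jacobiCoeff_recursion_nat h0.ne', ← mul_assoc]
      exact mul_le_mul_of_nonneg_right hratio (jacobiCoeff_nonneg h0.le m k)
    calc jacobiCoeff q m (k + 1 : ℕ)
        ≤ q ^ (2 * k + 1) * (q ^ (k ^ 2) * jacobiCoeff q m 0) :=
          hstep.trans (mul_le_mul_of_nonneg_left ih (by positivity))
      _ = q ^ ((k + 1) ^ 2) * jacobiCoeff q m 0 := by ring

lemma tendsto_jacobiCoeff_natCast_div {q : ℝ} (h0 : 0 < q) (h1 : q < 1) (k : ℕ) :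
    Tendsto (fun m => jacobiCoeff q m k / jacobiCoeff q m 0) atTop (𝓝 (q ^ (k ^ 2))) := by
  induction k with
  | zero => simp [(jacobiCoeff_zero_pos h0.le _).ne']
  | succ k ih =>
    have pow_tendsto (c : ℕ) : Tendsto (fun m => q ^ (2 * m + c)) atTop (𝓝 0) :=
      (tendsto_pow_atTop_nhds_zero_of_lt_one h0.le h1).comp <|
        tendsto_atTop_mono (fun m => show m ≤ 2 * m + c by omega) tendsto_id
    have hratio : Tendsto
        (fun m => (q ^ (2 * k + 1) - q ^ (2 * m + 1)) / (1 - q ^ (2 * m + (2 * k + 2)))) atTop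
        (𝓝 ((q ^ (2 * k + 1) - 0) / (1 - 0))) :=
      ((pow_tendsto 1).const_sub _).div ((pow_tendsto _).const_sub 1) (by norm_num)
    convert! hratio.mul ih using 1
    · funext m
      have hden : 1 - q ^ (2 * m + (2 * k + 2)) ≠ 0 :=
        (sub_pos.2 (pow_lt_one₀ h0.le h1 (by omega))).ne'
      rw [div_mul_div_comm, ← jacobiCoeff_recursion_nat h0.ne', add_assoc,
        mul_div_mul_left _ _ hden]
    · congr 1; ring

lemma summable_pow_natAbs_sq {q : ℝ} (h0 : 0 ≤ q) (h1 : q < 1) :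
    Summable (fun k : ℤ => q ^ (k.natAbs ^ 2)) := by
  have hnat : Summable (fun n : ℕ => q ^ (n ^ 2)) :=
    (summable_geometric_of_lt_one h0 h1).of_nonneg_of_le (fun n => by positivity)
      fun n => pow_le_pow_of_le_one h0 h1.le (Nat.le_self_pow two_ne_zero n)
  exact summable_int_iff_summable_nat_and_neg.2 ⟨by simpa using hnat, by simpa using hnat⟩

lemma norm_mul_cos_le {c : ℝ} (hc : 0 ≤ c) (x : ℝ) : ‖c * Real.cos x‖ ≤ c := by
  rw [norm_mul, Real.norm_of_nonneg hc]
  exact mul_le_of_le_one_right hc (Real.abs_cos_le_one x)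

lemma tendsto_jacobiProd_div {q : ℝ} (h0 : 0 < q) (h1 : q < 1) (w : ℝ) :
    Tendsto (fun m => jacobiProd q w m / jacobiCoeff q m 0) atTop (𝓝 (thetaCos q w)) := by
  have hsum (m : ℕ) : jacobiProd q w m / jacobiCoeff q m 0 =
      ∑' k : ℤ, jacobiCoeff q m k / jacobiCoeff q m 0 * Real.cos (k * w) := by
    rw [← ((hasSum_jacobiCoeff_mul_cos q w m).div_const _).tsum_eq]
    simp only [div_mul_eq_mul_div]
  simp_rw [hsum]
  refine tendsto_tsum_of_dominated_convergence (summable_pow_natAbs_sq h0.le h1)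
    (fun k => Tendsto.mul_const _ ?_) (Eventually.of_forall fun m k => ?_)
  · simpa only [jacobiCoeff_natAbs] using tendsto_jacobiCoeff_natCast_div h0 h1 k.natAbs
  · have hpos := jacobiCoeff_zero_pos h0.le m
    refine (norm_mul_cos_le (div_nonneg (jacobiCoeff_nonneg h0.le m k) hpos.le) _).trans ?_
    rw [div_le_iff₀ hpos, ← jacobiCoeff_natAbs]
    exact jacobiCoeff_natCast_le h0 h1 m k.natAbs

lemma jacobiProd_factor_nonneg {r c : ℝ} (hr : 0 ≤ r) (hc : -1 ≤ c) :
    0 ≤ 1 + r ^ 2 + r * (2 * c) := by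
  nlinarith [sq_nonneg (1 - r), mul_nonneg hr (sub_nonneg.2 hc)]

lemma thetaCos_le_of_cos_le {q : ℝ} (h0 : 0 < q) (h1 : q < 1) {w w' : ℝ}
    (hw : Real.cos w ≤ Real.cos w') : thetaCos q w ≤ thetaCos q w' := by
  refine le_of_tendsto_of_tendsto' (tendsto_jacobiProd_div h0 h1 w)
    (tendsto_jacobiProd_div h0 h1 w') fun m => ?_
  have := (jacobiCoeff_zero_pos h0.le m).le
  unfold jacobiProd
  gcongr
  intro j _
  rw [show 4 * j + 2 = (2 * j + 1) * 2 by ring, pow_mul]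
  exact jacobiProd_factor_nonneg (by positivity) (Real.neg_one_le_cos w)

lemma thetaCos_nonneg {q : ℝ} (h0 : 0 < q) (h1 : q < 1) (w : ℝ) : 0 ≤ thetaCos q w := by
  refine ge_of_tendsto' (tendsto_jacobiProd_div h0 h1 w) fun m => ?_
  refine div_nonneg (Finset.prod_nonneg fun j _ => ?_) (jacobiCoeff_zero_pos h0.le m).le
  rw [show 4 * j + 2 = (2 * j + 1) * 2 by ring, pow_mul]
  exact jacobiProd_factor_nonneg (by positivity) (Real.neg_one_le_cos w)

lemma continuous_thetaCos {q : ℝ} (h0 : 0 ≤ q) (h1 : q < 1) : Continuous (thetaCos q) :=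
  continuous_tsum (fun k => by fun_prop) (summable_pow_natAbs_sq h0 h1)
    fun k w => norm_mul_cos_le (by positivity) _

lemma thetaCos_periodic (q : ℝ) : Function.Periodic (thetaCos q) (2 * Real.pi) := by
  intro w
  refine tsum_congr fun k => ?_
  rw [mul_add, Real.cos_add_int_mul_two_pi]

lemma integral_cos_int_mul (k : ℤ) :
    ∫ w in (-Real.pi)..Real.pi, Real.cos (k * w) = if k = 0 then 2 * Real.pi else 0 := by
  split_ifs with hk
  · simp [hk, two_mul]
  · rw [intervalIntegral.integral_comp_mul_left _ (by exact_mod_cast hk : (k : ℝ) ≠ 0)]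
    simp [Real.sin_int_mul_pi]

lemma integral_thetaCos {q : ℝ} (h0 : 0 ≤ q) (h1 : q < 1) :
    ∫ w in (-Real.pi)..Real.pi, thetaCos q w = 2 * Real.pi := by
  have hsummable : Summable fun k : ℤ =>
      ‖(⟨fun w => q ^ (k.natAbs ^ 2) * Real.cos (k * w), by fun_prop⟩ : C(ℝ, ℝ)).restrict
        (⟨uIcc (-Real.pi) Real.pi, isCompact_uIcc⟩ : TopologicalSpace.Compacts ℝ)‖ := by
    refine (summable_pow_natAbs_sq h0 h1).of_nonneg_of_le (fun _ => norm_nonneg _) fun k => ?_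
    exact (ContinuousMap.norm_le _ (by positivity)).2 fun w => norm_mul_cos_le (by positivity) _
  have h := (intervalIntegral.hasSum_intervalIntegral_of_summable_norm hsummable).tsum_eq
  simpa [thetaCos, intervalIntegral.integral_const_mul, integral_cos_int_mul] using h.symm

lemma summable_pow_succ_sq_mul_cos {q : ℝ} (h0 : 0 ≤ q) (h1 : q < 1) (w : ℝ) :
    Summable (fun n : ℕ => q ^ ((n + 1) ^ 2) * Real.cos ((n + 1 : ℝ) * w)) := by
  have h := (summable_int_iff_summable_nat_and_neg.1 (summable_pow_natAbs_sq h0 h1)).1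
  exact ((summable_nat_add_iff 1).2 h).of_norm_bounded fun n => norm_mul_cos_le (by positivity) _

lemma thetaCos_eq_one_add {q : ℝ} (h0 : 0 ≤ q) (h1 : q < 1) (w : ℝ) :
    thetaCos q w = 1 + 2 * ∑' n : ℕ, q ^ ((n + 1) ^ 2) * Real.cos ((n + 1 : ℝ) * w) := by
  have hpos (n : ℕ) : q ^ (((n : ℤ) + 1).natAbs ^ 2) * Real.cos (((n : ℤ) + 1 : ℤ) * w) =
      q ^ ((n + 1) ^ 2) * Real.cos ((n + 1 : ℝ) * w) := by
    push_cast
    rfl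
  have hneg (n : ℕ) : q ^ ((-((n : ℤ) + 1)).natAbs ^ 2) * Real.cos ((-((n : ℤ) + 1) : ℤ) * w) =
      q ^ ((n + 1) ^ 2) * Real.cos ((n + 1 : ℝ) * w) := by
    rw [Int.natAbs_neg, Int.cast_neg, neg_mul, Real.cos_neg, hpos]
  have h := (summable_pow_succ_sq_mul_cos h0 h1 w).hasSum
  have hsum := HasSum.of_add_one_of_neg_add_one
    (f := fun k : ℤ => q ^ (k.natAbs ^ 2) * Real.cos (k * w))
    (by simpa only [hpos] using h) (by simpa only [hneg] using h)
  rw [thetaCos, hsum.tsum_eq]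
  simp only [Int.natAbs_zero, ne_eq, OfNat.ofNat_ne_zero, not_false_eq_true, zero_pow, pow_zero,
    Int.cast_zero, zero_mul, Real.cos_zero, mul_one]
  ring

end Theta

section HeatKernel

lemma exp_neg_pi_sq_mul_lt_one {t : ℝ} (ht : 0 < t) : Real.exp (-(Real.pi ^ 2 * t)) < 1 :=
  Real.exp_lt_one_iff.2 (neg_neg_of_pos (by positivity))

lemma dirichletHeatKernel_eq_thetaCos_sub {t : ℝ} (ht : 0 < t) (x y : ℝ) :
    dirichletHeatKernel t x y =
      (thetaCos (Real.exp (-(Real.pi ^ 2 * t))) (Real.pi * (x - y)) -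
        thetaCos (Real.exp (-(Real.pi ^ 2 * t))) (Real.pi * (x + y))) / 2 := by
  set q := Real.exp (-(Real.pi ^ 2 * t)) with hq
  have h0 : 0 ≤ q := (Real.exp_pos _).le
  have h1 : q < 1 := exp_neg_pi_sq_mul_lt_one ht
  have hexp (n : ℕ) : Real.exp (-((n + 1 : ℝ) ^ 2 * Real.pi ^ 2 * t)) = q ^ ((n + 1) ^ 2) := by
    rw [hq, ← Real.exp_nat_mul]
    push_cast
    ring_nf
  rw [thetaCos_eq_one_add h0 h1, thetaCos_eq_one_add h0 h1, add_sub_add_left_eq_sub, ← mul_sub,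
    mul_div_cancel_left₀ _ two_ne_zero,
    ← (summable_pow_succ_sq_mul_cos h0 h1 _).tsum_sub (summable_pow_succ_sq_mul_cos h0 h1 _)]
  refine tsum_congr fun n => ?_
  rw [hexp, mul_sub Real.pi, mul_add Real.pi, mul_sub, mul_add, Real.cos_sub, Real.cos_add]
  ring_nf

lemma continuous_dirichletHeatKernel {t : ℝ} (ht : 0 < t) (x : ℝ) :
    Continuous (dirichletHeatKernel t x) := by
  have := continuous_thetaCos (Real.exp_pos _).le (exp_neg_pi_sq_mul_lt_one ht)
  rw [funext (dirichletHeatKernel_eq_thetaCos_sub ht x)]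
  fun_prop

lemma dirichletHeatKernel_nonneg {t : ℝ} (ht : 0 < t) (x y : unitInterval) :
    0 ≤ dirichletHeatKernel t x y := by
  have sin_nonneg (z : unitInterval) : 0 ≤ Real.sin (Real.pi * z) :=
    Real.sin_nonneg_of_nonneg_of_le_pi (mul_nonneg Real.pi_pos.le z.2.1)
      (mul_le_of_le_one_right Real.pi_pos.le z.2.2)
  have hcos : Real.cos (Real.pi * (x + y)) ≤ Real.cos (Real.pi * (x - y)) := by
    rw [mul_sub, mul_add, Real.cos_sub, Real.cos_add]
    linarith [mul_nonneg (sin_nonneg x) (sin_nonneg y)]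
  rw [dirichletHeatKernel_eq_thetaCos_sub ht]
  linarith [thetaCos_le_of_cos_le (Real.exp_pos _) (exp_neg_pi_sq_mul_lt_one ht) hcos]

lemma integral_thetaCos_sub_mul_le {q : ℝ} (h0 : 0 < q) (h1 : q < 1) (w : ℝ) :
    ∫ y in (0 : ℝ)..1, thetaCos q (w - Real.pi * y) ≤ 2 := by
  have hπ := Real.pi_pos
  calc ∫ y in (0 : ℝ)..1, thetaCos q (w - Real.pi * y)
      = Real.pi⁻¹ * ∫ v in (w - Real.pi)..w, thetaCos q v := by
        rw [intervalIntegral.integral_comp_sub_mul (thetaCos q) hπ.ne', mul_one, mul_zero,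
          sub_zero, smul_eq_mul]
    _ ≤ Real.pi⁻¹ * ∫ v in (w - Real.pi)..(w - Real.pi + 2 * Real.pi), thetaCos q v := by
        gcongr
        exact intervalIntegral.integral_mono_interval le_rfl (by linarith) (by linarith)
          (Eventually.of_forall (thetaCos_nonneg h0 h1))
          ((continuous_thetaCos h0.le h1).intervalIntegrable _ _)
    _ = Real.pi⁻¹ * ∫ v in (-Real.pi)..Real.pi, thetaCos q v := by
        rw [(thetaCos_periodic q).intervalIntegral_add_eq (w - Real.pi) (-Real.pi)]
        congr 2
        ring
    _ = 2 := by
        rw [integral_thetaCos h0.le h1]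
        field_simp

lemma integral_dirichletHeatKernel_le_one {t : ℝ} (ht : 0 < t) (x : ℝ) :
    ∫ y : unitInterval, dirichletHeatKernel t x y ≤ 1 := by
  set q := Real.exp (-(Real.pi ^ 2 * t))
  have h0 : 0 < q := Real.exp_pos _
  have h1 : q < 1 := exp_neg_pi_sq_mul_lt_one ht
  have hcont := continuous_thetaCos h0.le h1
  calc ∫ y : unitInterval, dirichletHeatKernel t x y
      = ∫ y in (0 : ℝ)..1, dirichletHeatKernel t x y := by
        rw [intervalIntegral.integral_of_le zero_le_one, ← integral_Icc_eq_integral_Ioc]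
        exact integral_subtype measurableSet_Icc _
    _ ≤ ∫ y in (0 : ℝ)..1, thetaCos q (Real.pi * x - Real.pi * y) / 2 := by
        refine intervalIntegral.integral_mono_on zero_le_one
          ((continuous_dirichletHeatKernel ht x).intervalIntegrable _ _)
          (Continuous.intervalIntegrable (by fun_prop) _ _) fun y _ => ?_
        rw [dirichletHeatKernel_eq_thetaCos_sub ht, ← mul_sub]
        linarith [thetaCos_nonneg h0 h1 (Real.pi * (x + y))]
    _ ≤ 1 := by
        rw [intervalIntegral.integral_div]
        linarith [integral_thetaCos_sub_mul_le h0 h1 (Real.pi * x)]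

lemma abs_integral_dirichletHeatKernel_mul_le {t : ℝ} (ht : 0 < t) (x : unitInterval)
    {f : unitInterval → ℝ} {M : ℝ} (hM : 0 ≤ M) (hf : ∀ᵐ y, |f y| ≤ M) :
    |∫ y : unitInterval, dirichletHeatKernel t x y * f y| ≤ M := by
  have hint : Integrable (fun y : unitInterval => dirichletHeatKernel t x y * M) :=
    (((continuous_dirichletHeatKernel ht x).comp continuous_subtype_val).mul_const M
      ).integrable_of_hasCompactSupport (HasCompactSupport.of_compactSpace _)
  calc |∫ y : unitInterval, dirichletHeatKernel t x y * f y|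
      ≤ ∫ y : unitInterval, dirichletHeatKernel t x y * M := by
        rw [← Real.norm_eq_abs]
        refine norm_integral_le_of_norm_le hint ?_
        filter_upwards [hf] with y hy
        rw [norm_mul, Real.norm_of_nonneg (dirichletHeatKernel_nonneg ht x y)]
        exact mul_le_mul_of_nonneg_left hy (dirichletHeatKernel_nonneg ht x y)
    _ ≤ 1 * M := by
        rw [integral_mul_const]
        exact mul_le_mul_of_nonneg_right (integral_dirichletHeatKernel_le_one ht x) hM
    _ = M := one_mul M

end HeatKernel

section L2

variable {α : Type*} {mα : MeasurableSpace α} {μ : Measure α}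

lemma inner_toLp_eq_integral {f g : α → ℝ} (hf : MemLp f 2 μ) (hg : MemLp g 2 μ) :
    inner ℝ (hf.toLp f) (hg.toLp g) = ∫ a, f a * g a ∂μ := by
  rw [L2.inner_def]
  refine integral_congr_ae ?_
  filter_upwards [hf.coeFn_toLp, hg.coeFn_toLp] with a ha hb
  rw [ha, hb, RCLike.inner_apply, conj_trivial, mul_comm]

lemma tendsto_integral_mul_of_eLpNorm {f g : ℕ → α → ℝ} {f' g' : α → ℝ}
    (hf : ∀ n, MemLp (f n) 2 μ) (hf' : MemLp f' 2 μ)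
    (hg : ∀ n, MemLp (g n) 2 μ) (hg' : MemLp g' 2 μ)
    (hff' : Tendsto (fun n => eLpNorm (fun a => f n a - f' a) 2 μ) atTop (𝓝 0))
    (hgg' : Tendsto (fun n => eLpNorm (fun a => g n a - g' a) 2 μ) atTop (𝓝 0)) :
    Tendsto (fun n => ∫ a, f n a * g n a ∂μ) atTop (𝓝 (∫ a, f' a * g' a ∂μ)) := by
  have hF := (Lp.tendsto_Lp_iff_tendsto_eLpNorm'' f hf f' hf').2 hff'
  have hG := (Lp.tendsto_Lp_iff_tendsto_eLpNorm'' g hg g' hg').2 hgg'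
  simpa only [inner_toLp_eq_integral] using hF.inner (𝕜 := ℝ) hG

lemma tendsto_eLpNorm_sum_mul_sub {ι : Type*} {p : ℝ≥0∞} (hp : 1 ≤ p) (s : Finset ι) (c : ι → ℝ)
    {f : ℕ → ι → α → ℝ} {g : ι → α → ℝ} (hf : ∀ n i, AEStronglyMeasurable (f n i) μ)
    (hg : ∀ i, AEStronglyMeasurable (g i) μ)
    (h : ∀ i, Tendsto (fun n => eLpNorm (fun a => f n i a - g i a) p μ) atTop (𝓝 0)) :
    Tendsto (fun n => eLpNorm (fun a => ∑ i ∈ s, c i * f n i a - ∑ i ∈ s, c i * g i a) p μ)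
      atTop (𝓝 0) := by
  have triangle (n : ℕ) :
      eLpNorm (fun a => ∑ i ∈ s, c i * f n i a - ∑ i ∈ s, c i * g i a) p μ ≤
        ∑ i ∈ s, ‖c i‖ₑ * eLpNorm (fun a => f n i a - g i a) p μ := by
    rw [show (fun a => ∑ i ∈ s, c i * f n i a - ∑ i ∈ s, c i * g i a) =
        ∑ i ∈ s, c i • fun a => f n i a - g i a by
      funext a
      simp [← Finset.sum_sub_distrib, mul_sub]]
    refine (eLpNorm_sum_le (fun i _ => ((hf n i).sub (hg i)).const_smul _) hp).trans ?_
    exact Finset.sum_le_sum fun i _ => eLpNorm_const_smul_le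
  have bound_tendsto : Tendsto
      (fun n => ∑ i ∈ s, ‖c i‖ₑ * eLpNorm (fun a => f n i a - g i a) p μ) atTop (𝓝 0) := by
    simpa using tendsto_finsetSum s fun i _ =>
      ENNReal.Tendsto.const_mul (h i) (Or.inr (enorm_ne_top (x := c i)))
  exact tendsto_of_tendsto_of_tendsto_of_le_of_le tendsto_const_nhds bound_tendsto
    (fun _ => zero_le) triangle

lemma memLp_sum_mul {ι : Type*} {p : ℝ≥0∞} (s : Finset ι) (c : ι → ℝ) {g : ι → α → ℝ}
    (hg : ∀ i, MemLp (g i) p μ) : MemLp (fun a => ∑ i ∈ s, c i * g i a) p μ :=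
  memLp_finsetSum s fun i _ => (hg i).const_mul (c i)

lemma integral_sum_mul_sum {ι κ : Type*} (s : Finset ι) (t : Finset κ) {F : ι → α → ℝ}
    {G : κ → α → ℝ} (hF : ∀ i, MemLp (F i) 2 μ) (hG : ∀ j, MemLp (G j) 2 μ) :
    ∫ a, (∑ i ∈ s, F i a) * (∑ j ∈ t, G j a) ∂μ =
      ∑ i ∈ s, ∑ j ∈ t, ∫ a, F i a * G j a ∂μ := by
  have hint (i : ι) (j : κ) : Integrable (fun a => F i a * G j a) μ := (hF i).integrable_mul (hG j)
  simp_rw [Finset.sum_mul_sum]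
  rw [integral_finsetSum _ fun i _ => integrable_finsetSum _ fun j _ => hint i j]
  exact Finset.sum_congr rfl fun i _ => integral_finsetSum _ fun j _ => hint i j

lemma integral_sq_sum_mul {ι : Type*} (s : Finset ι) (c : ι → ℝ) {F : ι → α → ℝ}
    (hF : ∀ i, MemLp (F i) 2 μ) :
    ∫ a, (∑ i ∈ s, c i * F i a) ^ 2 ∂μ =
      ∑ i ∈ s, ∑ j ∈ s, c i * c j * ∫ a, F i a * F j a ∂μ := by
  simp_rw [sq]
  rw [integral_sum_mul_sum s s (fun i => (hF i).const_mul (c i)) fun i => (hF i).const_mul (c i)]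
  simp_rw [mul_mul_mul_comm (c _), integral_const_mul]

lemma simpleFunc_eq_sum_indicator (f : SimpleFunc α ℝ) (a : α) :
    f a = ∑ c ∈ f.range, c * (f ⁻¹' {c}).indicator (fun _ => (1 : ℝ)) a := by
  rw [Finset.sum_eq_single_of_mem (f a) (f.mem_range_self a)]
  · simp
  · intro c _ hc
    rw [Set.indicator_of_notMem (by simpa using hc.symm), mul_zero]

lemma exists_seq_simpleFunc_tendsto_eLpNorm {E : Type*} [NormedAddCommGroup E] {p : ℝ≥0∞}
    (hp : p ≠ ∞) {h : α → E} (hh : MemLp h p μ) :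
    ∃ f : ℕ → SimpleFunc α E, (∀ n, MemLp (f n) p μ) ∧
      Tendsto (fun n => eLpNorm (fun a => f n a - h a) p μ) atTop (𝓝 0) := by
  have approx (n : ℕ) := hh.exists_simpleFunc_eLpNorm_sub_lt hp
    (ε := (n : ℝ≥0∞)⁻¹) (by simp)
  choose f hfh hf using approx
  refine ⟨f, hf, tendsto_of_tendsto_of_tendsto_of_le_of_le tendsto_const_nhds
    ENNReal.tendsto_inv_nat_nhds_zero (fun _ => zero_le) fun n => ?_⟩
  exact (eLpNorm_sub_comm (f n) h p μ).trans_le (hfh n).le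

lemma tendsto_integral_cexp_of_eLpNorm [IsFiniteMeasure μ] {p : ℝ≥0∞} (hp : p ≠ 0)
    {f : ℕ → α → ℝ} {g : α → ℝ} (hf : ∀ n, AEStronglyMeasurable (f n) μ)
    (hg : AEStronglyMeasurable g μ)
    (h : Tendsto (fun n => eLpNorm (fun a => f n a - g a) p μ) atTop (𝓝 0)) :
    Tendsto (fun n => ∫ a, Complex.exp (f n a * Complex.I) ∂μ) atTop
      (𝓝 (∫ a, Complex.exp (g a * Complex.I) ∂μ)) := by
  refine tendsto_of_subseq_tendsto fun ns hns => ?_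
  obtain ⟨ms, -, hlim⟩ := (tendstoInMeasure_of_tendsto_eLpNorm hp (fun n => hf (ns n)) hg
    (h.comp hns)).exists_seq_tendsto_ae
  refine ⟨ms, tendsto_integral_of_dominated_convergence (fun _ => 1) (fun n => ?_)
    (integrable_const _) (fun n => ?_) ?_⟩
  · have := (hf (ns (ms n))).aemeasurable
    exact AEMeasurable.aestronglyMeasurable (by fun_prop)
  · exact Eventually.of_forall fun a => (Complex.norm_exp_ofReal_mul_I _).le
  · have hcont : Continuous fun x : ℝ => Complex.exp (x * Complex.I) := by fun_prop
    filter_upwards [hlim] with a ha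
    exact (hcont.tendsto _).comp ha

end L2

section CramerWold

variable {Ω : Type*} {mΩ : MeasurableSpace Ω} {P : Measure Ω} [IsFiniteMeasure P]

lemma map_eq_map_of_charFun_eq_of_fintype {ι : Type*} [Fintype ι] {X Y : ι → Ω → ℝ}
    (hX : ∀ i, AEMeasurable (X i) P) (hY : ∀ i, AEMeasurable (Y i) P)
    (h : ∀ c : ι → ℝ, ∫ ω, Complex.exp ((∑ i, c i * X i ω : ℝ) * Complex.I) ∂P =
      ∫ ω, Complex.exp ((∑ i, c i * Y i ω : ℝ) * Complex.I) ∂P) :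
    P.map (fun ω i => X i ω) = P.map (fun ω i => Y i ω) := by
  classical
  have charFun_eq (L : StrongDual ℝ (ι → ℝ)) {Z : ι → Ω → ℝ} (hZ : ∀ i, AEMeasurable (Z i) P) :
      charFunDual (P.map fun ω i => Z i ω) L =
        ∫ ω, Complex.exp ((∑ i, L (Pi.single i 1) * Z i ω : ℝ) * Complex.I) ∂P := by
    rw [charFunDual_apply, integral_map (aemeasurable_pi_iff.2 hZ) (by fun_prop)]
    refine integral_congr_ae (Eventually.of_forall fun ω => ?_)
    have expand : L (fun i => Z i ω) = ∑ i, L (Pi.single i 1) * Z i ω := by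
      rw [← ContinuousLinearMap.coe_coe, LinearMap.pi_apply_eq_sum_univ]
      refine Finset.sum_congr rfl fun i _ => ?_
      rw [smul_eq_mul, mul_comm]
      congr 2
      funext j
      simp [Pi.single_apply, eq_comm]
    simp only [expand]
  refine Measure.ext_of_charFunDual (funext fun L => ?_)
  rw [charFun_eq L hX, charFun_eq L hY, h]

lemma map_eq_map_of_charFun_eq {ι : Type*} [Countable ι] {X Y : ι → Ω → ℝ}
    (hX : ∀ i, AEMeasurable (X i) P) (hY : ∀ i, AEMeasurable (Y i) P)
    (h : ∀ (I : Finset ι) (c : I → ℝ),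
      ∫ ω, Complex.exp ((∑ i, c i * X i ω : ℝ) * Complex.I) ∂P =
        ∫ ω, Complex.exp ((∑ i, c i * Y i ω : ℝ) * Complex.I) ∂P) :
    P.map (fun ω i => X i ω) = P.map (fun ω i => Y i ω) := by
  rw [map_eq_iff_forall_finset_map_restrict_eq (aemeasurable_pi_iff.2 hX)
    (aemeasurable_pi_iff.2 hY)]
  exact fun I => map_eq_map_of_charFun_eq_of_fintype (fun i : I => hX i) (fun i => hY i) (h I)

end CramerWold

section WienerIntegral

variable {Ω : Type*} {mΩ : MeasurableSpace Ω} {P : Measure Ω} {ℱ : Filtration ℝ≥0 mΩ}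
  {W : Set SpaceTime → Ω → ℝ}

/-- The linear span of the noise of the sets of finite measure, the dense part of the Gaussian
space of the noise. Its elements are functions, not almost everywhere classes. -/
def noiseSpan (W : Set SpaceTime → Ω → ℝ) : Submodule ℝ (Ω → ℝ) :=
  Submodule.span ℝ (Set.range fun A : {A : Set SpaceTime // MeasurableSet A ∧ leb A ≠ ∞} => W A.1)

lemma measure_fiber_ne_top {α : Type*} [MeasurableSpace α] {μ : Measure α}
    {f : SimpleFunc α ℝ} (hf : MemLp f 2 μ) {c : ℝ} (hc : c ≠ 0) : μ (f ⁻¹' {c}) ≠ ∞ :=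
  (SimpleFunc.measure_preimage_lt_top_of_memLp two_ne_zero ENNReal.ofNat_ne_top f hf c hc).ne

lemma mul_noise_fiber_mem_noiseSpan {f : SimpleFunc SpaceTime ℝ} (hf : MemLp f 2 leb) (c : ℝ) :
    (fun ω => c * W (f ⁻¹' {c}) ω) ∈ noiseSpan W := by
  rcases eq_or_ne c 0 with rfl | hc
  · simp only [zero_mul]
    exact Submodule.zero_mem _
  · exact Submodule.smul_mem _ c
      (Submodule.subset_span ⟨⟨_, f.measurableSet_fiber c, measure_fiber_ne_top hf hc⟩, rfl⟩)

lemma simpleWienerIntegral_mem_noiseSpan {f : SimpleFunc SpaceTime ℝ} (hf : MemLp f 2 leb) :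
    simpleWienerIntegral W f ∈ noiseSpan W := by
  convert! Submodule.sum_mem (noiseSpan W) fun c (_ : c ∈ f.range) =>
    mul_noise_fiber_mem_noiseSpan hf c using 1
  funext ω
  simp [simpleWienerIntegral]

namespace IsWhiteNoise

lemma memLp (hW : IsWhiteNoise P ℱ W) {A : Set SpaceTime} (hA : MeasurableSet A)
    (hA' : leb A ≠ ∞) : MemLp (W A) 2 P :=
  (hW.gaussian.hasGaussianLaw_eval ⟨A, hA, hA'⟩).memLp_two

lemma hasGaussianLaw_of_mem_noiseSpan (hW : IsWhiteNoise P ℱ W) {Y : Ω → ℝ}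
    (hY : Y ∈ noiseSpan W) : HasGaussianLaw Y P := by
  obtain ⟨c, rfl⟩ := Finsupp.mem_span_range_iff_exists_finsupp.1 hY
  exact (hW.gaussian.smul c).hasGaussianLaw_sum

lemma integral_eq_zero_of_mem_noiseSpan (hW : IsWhiteNoise P ℱ W) {Y : Ω → ℝ}
    (hY : Y ∈ noiseSpan W) : ∫ ω, Y ω ∂P = 0 := by
  have := hW.gaussian.isProbabilityMeasure
  obtain ⟨c, rfl⟩ := Finsupp.mem_span_range_iff_exists_finsupp.1 hY
  simp only [Finsupp.sum, Finset.sum_apply, Pi.smul_apply, smul_eq_mul]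
  rw [integral_finsetSum _ fun A _ =>
    ((hW.memLp A.2.1 A.2.2).integrable one_le_two).const_mul _]
  refine Finset.sum_eq_zero fun A _ => ?_
  rw [integral_const_mul, hW.mean_zero _ A.2.1 A.2.2, mul_zero]

lemma integral_cexp_of_mem_noiseSpan (hW : IsWhiteNoise P ℱ W) {Y : Ω → ℝ}
    (hY : Y ∈ noiseSpan W) :
    ∫ ω, Complex.exp (Y ω * Complex.I) ∂P = Complex.exp (-(∫ ω, Y ω * Y ω ∂P : ℝ) / 2) := by
  have hmean := hW.integral_eq_zero_of_mem_noiseSpan hY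
  have hlaw := hW.hasGaussianLaw_of_mem_noiseSpan hY
  have h := hlaw.charFun_map_eq 1
  rw [charFun_apply_real, integral_map hlaw.aemeasurable (by fun_prop)] at h
  simp only [Complex.ofReal_one, one_mul, RCLike.inner_apply, map_one, mul_one, hmean,
    Complex.ofReal_zero, zero_mul, zero_sub,
    variance_of_integral_eq_zero hlaw.aemeasurable hmean] at h
  simpa only [← sq, neg_div] using h

lemma integral_cexp_of_tendsto (hW : IsWhiteNoise P ℱ W) {Y : ℕ → Ω → ℝ} {Z : Ω → ℝ}
    (hY : ∀ n, Y n ∈ noiseSpan W) (hZ : MemLp Z 2 P)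
    (h : Tendsto (fun n => eLpNorm (fun ω => Y n ω - Z ω) 2 P) atTop (𝓝 0)) :
    ∫ ω, Complex.exp (Z ω * Complex.I) ∂P = Complex.exp (-(∫ ω, Z ω * Z ω ∂P : ℝ) / 2) := by
  have := hW.gaussian.isProbabilityMeasure
  have hYm n := (hW.hasGaussianLaw_of_mem_noiseSpan (hY n)).memLp_two
  have hcont : Continuous fun v : ℝ => Complex.exp (-(v : ℂ) / 2) := by fun_prop
  refine tendsto_nhds_unique
    (tendsto_integral_cexp_of_eLpNorm two_ne_zero (fun n => (hYm n).1) hZ.1 h)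
    (((hcont.tendsto _).comp (tendsto_integral_mul_of_eLpNorm hYm hZ hYm hZ h h)).congr
      fun n => (hW.integral_cexp_of_mem_noiseSpan (hY n)).symm)

lemma memLp_simpleWienerIntegral (hW : IsWhiteNoise P ℱ W) {f : SimpleFunc SpaceTime ℝ}
    (hf : MemLp f 2 leb) : MemLp (simpleWienerIntegral W f) 2 P :=
  (hW.hasGaussianLaw_of_mem_noiseSpan (simpleWienerIntegral_mem_noiseSpan hf)).memLp_two

lemma integral_mul_noise_fiber (hW : IsWhiteNoise P ℱ W) {f g : SimpleFunc SpaceTime ℝ}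
    (hf : MemLp f 2 leb) (hg : MemLp g 2 leb) (c d : ℝ) :
    ∫ ω, (c * W (f ⁻¹' {c}) ω) * (d * W (g ⁻¹' {d}) ω) ∂P =
      ∫ z, (c * (f ⁻¹' {c}).indicator (fun _ => (1 : ℝ)) z) *
        (d * (g ⁻¹' {d}).indicator (fun _ => (1 : ℝ)) z) ∂leb := by
  rcases eq_or_ne c 0 with rfl | hc
  · simp
  rcases eq_or_ne d 0 with rfl | hd
  · simp
  simp_rw [mul_mul_mul_comm c _ d _, integral_const_mul, ← Set.inter_indicator_mul, mul_one]
  rw [hW.covariance _ _ (f.measurableSet_fiber c) (measure_fiber_ne_top hf hc)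
    (g.measurableSet_fiber d) (measure_fiber_ne_top hg hd), integral_indicator_const _
    ((f.measurableSet_fiber c).inter (g.measurableSet_fiber d)), smul_eq_mul, mul_one,
    Measure.real]

lemma integral_simpleWienerIntegral_mul (hW : IsWhiteNoise P ℱ W) {f g : SimpleFunc SpaceTime ℝ}
    (hf : MemLp f 2 leb) (hg : MemLp g 2 leb) :
    ∫ ω, simpleWienerIntegral W f ω * simpleWienerIntegral W g ω ∂P = ∫ z, f z * g z ∂leb := by
  have noise_memLp {k : SimpleFunc SpaceTime ℝ} (hk : MemLp k 2 leb) (c : ℝ) :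
      MemLp (fun ω => c * W (k ⁻¹' {c}) ω) 2 P :=
    (hW.hasGaussianLaw_of_mem_noiseSpan (mul_noise_fiber_mem_noiseSpan hk c)).memLp_two
  have indicator_memLp {k : SimpleFunc SpaceTime ℝ} (hk : MemLp k 2 leb) (c : ℝ) :
      MemLp (fun z => c * (k ⁻¹' {c}).indicator (fun _ => (1 : ℝ)) z) 2 leb := by
    rcases eq_or_ne c 0 with rfl | hc
    · simp
    · exact (memLp_indicator_const 2 (k.measurableSet_fiber c) 1
        (Or.inr (measure_fiber_ne_top hk hc))).const_mul c
  simp_rw [simpleFunc_eq_sum_indicator, simpleWienerIntegral]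
  rw [integral_sum_mul_sum _ _ (noise_memLp hf) (noise_memLp hg),
    integral_sum_mul_sum _ _ (indicator_memLp hf) (indicator_memLp hg)]
  exact Finset.sum_congr rfl fun c _ => Finset.sum_congr rfl fun d _ =>
    hW.integral_mul_noise_fiber hf hg c d

lemma integral_mul_eq (hW : IsWhiteNoise P ℱ W) {h h' : SpaceTime → ℝ} {X X' : Ω → ℝ}
    (hX : HasWienerIntegral P W h X) (hX' : HasWienerIntegral P W h' X') :
    ∫ ω, X ω * X' ω ∂P = ∫ z, h z * h' z ∂leb := by
  obtain ⟨hh, hXm, f, hf, hfh, hfX⟩ := hX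
  obtain ⟨hh', hXm', f', hf', hfh', hfX'⟩ := hX'
  refine tendsto_nhds_unique
    (tendsto_integral_mul_of_eLpNorm (fun n => hW.memLp_simpleWienerIntegral (hf n)) hXm
      (fun n => hW.memLp_simpleWienerIntegral (hf' n)) hXm' hfX hfX')
    ((tendsto_integral_mul_of_eLpNorm hf hh hf' hh' hfh hfh').congr fun n => ?_)
  rw [hW.integral_simpleWienerIntegral_mul (hf n) (hf' n)]

lemma integral_sq_sum (hW : IsWhiteNoise P ℱ W) {ι : Type*} (s : Finset ι) (c : ι → ℝ)
    {h : ι → SpaceTime → ℝ} {X : ι → Ω → ℝ} (hX : ∀ i, HasWienerIntegral P W (h i) (X i)) :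
    ∫ ω, (∑ i ∈ s, c i * X i ω) ^ 2 ∂P = ∫ z, (∑ i ∈ s, c i * h i z) ^ 2 ∂leb := by
  rw [integral_sq_sum_mul s c fun i => (hX i).2.1, integral_sq_sum_mul s c fun i => (hX i).1]
  simp_rw [hW.integral_mul_eq (hX _) (hX _)]

lemma integral_cexp_sum (hW : IsWhiteNoise P ℱ W) {ι : Type*} (s : Finset ι) (c : ι → ℝ)
    {h : ι → SpaceTime → ℝ} {X : ι → Ω → ℝ} (hX : ∀ i, HasWienerIntegral P W (h i) (X i)) :
    ∫ ω, Complex.exp ((∑ i ∈ s, c i * X i ω : ℝ) * Complex.I) ∂P =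
      Complex.exp (-(∑ i ∈ s, ∑ j ∈ s, c i * c j * ∫ z, h i z * h j z ∂leb : ℝ) / 2) := by
  rw [← integral_sq_sum_mul s c fun i => (hX i).1, ← hW.integral_sq_sum s c hX]
  simp_rw [sq]
  choose _ hXm f hf _ hfX using hX
  refine hW.integral_cexp_of_tendsto
    (Y := fun n => ∑ i ∈ s, c i • simpleWienerIntegral W (f i n)) (fun n => ?_)
    (memLp_sum_mul s c hXm) ?_
  · exact Submodule.sum_mem _ fun i _ =>
      Submodule.smul_mem _ _ (simpleWienerIntegral_mem_noiseSpan (hf i n))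
  · simpa only [Finset.sum_apply, Pi.smul_apply, smul_eq_mul] using
      tendsto_eLpNorm_sum_mul_sub one_le_two s c
        (fun n i => (hW.memLp_simpleWienerIntegral (hf i n)).1) (fun i => (hXm i).1) hfX

lemma ae_eq_add_const_mul (hW : IsWhiteNoise P ℱ W) {h h₁ h₂ : SpaceTime → ℝ} {X X₁ X₂ : Ω → ℝ}
    {c : ℝ} (hX : HasWienerIntegral P W h X) (hX₁ : HasWienerIntegral P W h₁ X₁)
    (hX₂ : HasWienerIntegral P W h₂ X₂) (hh : ∀ z, h z = h₁ z + c * h₂ z) :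
    ∀ᵐ ω ∂P, X ω = X₁ ω + c * X₂ ω := by
  have hint : Integrable (fun ω => (X ω - (X₁ ω + c * X₂ ω)) ^ 2) P :=
    (hX.2.1.sub (hX₁.2.1.add (hX₂.2.1.const_mul c))).integrable_sq
  have hzero : ∫ ω, (X ω - (X₁ ω + c * X₂ ω)) ^ 2 ∂P = 0 := by
    have h := hW.integral_sq_sum (ι := Fin 3) Finset.univ ![1, -1, -c] (h := ![h, h₁, h₂])
      (X := ![X, X₁, X₂]) (fun i => by fin_cases i <;> assumption)
    simpa [Fin.sum_univ_three, hh, sub_eq_add_neg, add_assoc, add_comm] using h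
  filter_upwards [(integral_eq_zero_iff_of_nonneg (fun ω => sq_nonneg _) hint).1 hzero] with ω hω
  exact sub_eq_zero.1 (pow_eq_zero_iff two_ne_zero |>.1 hω)

lemma wienerIntegral_unique (hW : IsWhiteNoise P ℱ W) {h : SpaceTime → ℝ} {X Y : Ω → ℝ}
    (hX : HasWienerIntegral P W h X) (hY : HasWienerIntegral P W h Y) :
    ∀ᵐ ω ∂P, X ω = Y ω := by
  simpa using! hW.ae_eq_add_const_mul (c := 0) hX hY hY (by simp)

lemma dist_toLp_simpleWienerIntegral (hW : IsWhiteNoise P ℱ W) {f g : SimpleFunc SpaceTime ℝ}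
    (hf : MemLp f 2 leb) (hg : MemLp g 2 leb) :
    dist ((hW.memLp_simpleWienerIntegral hf).toLp _) ((hW.memLp_simpleWienerIntegral hg).toLp _) =
      dist (hf.toLp f) (hg.toLp g) := by
  rw [dist_eq_norm, dist_eq_norm, ← sq_eq_sq₀ (norm_nonneg _) (norm_nonneg _),
    norm_sub_sq_real, norm_sub_sq_real]
  simp_rw [← real_inner_self_eq_norm_sq, inner_toLp_eq_integral]
  rw [hW.integral_simpleWienerIntegral_mul hf hf, hW.integral_simpleWienerIntegral_mul hf hg,
    hW.integral_simpleWienerIntegral_mul hg hg]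

lemma exists_wienerIntegral (hW : IsWhiteNoise P ℱ W) {h : SpaceTime → ℝ} (hh : MemLp h 2 leb) :
    ∃ X : Ω → ℝ, HasWienerIntegral P W h X := by
  obtain ⟨f, hf, hlim⟩ := exists_seq_simpleFunc_tendsto_eLpNorm ENNReal.ofNat_ne_top hh
  have hI n := hW.memLp_simpleWienerIntegral (hf n)
  have hcauchy : CauchySeq fun n => (hI n).toLp _ := by
    have h := ((Lp.tendsto_Lp_iff_tendsto_eLpNorm'' (fun n => f n) hf h hh).2 hlim).cauchySeq
    rw [Metric.cauchySeq_iff] at h ⊢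
    simpa only [hW.dist_toLp_simpleWienerIntegral (hf _) (hf _)] using h
  obtain ⟨X, hX⟩ := cauchySeq_tendsto_of_complete hcauchy
  refine ⟨X, hh, Lp.memLp X, f, hf, hlim, ?_⟩
  exact (Lp.tendsto_Lp_iff_tendsto_eLpNorm'' (fun n => simpleWienerIntegral W (f n)) hI X
    (Lp.memLp X)).1 (by rwa [Lp.toLp_coeFn])

lemma map_eq_map (hW : IsWhiteNoise P ℱ W) {ι : Type*} [Countable ι]
    {h h' : ι → SpaceTime → ℝ} {X X' : ι → Ω → ℝ}
    (hX : ∀ i, HasWienerIntegral P W (h i) (X i))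
    (hX' : ∀ i, HasWienerIntegral P W (h' i) (X' i))
    (hcov : ∀ i j, ∫ z, h i z * h j z ∂leb = ∫ z, h' i z * h' j z ∂leb) :
    P.map (fun ω i => X i ω) = P.map (fun ω i => X' i ω) := by
  have := hW.gaussian.isProbabilityMeasure
  refine map_eq_map_of_charFun_eq (fun i => (hX i).2.1.1.aemeasurable)
    (fun i => (hX' i).2.1.1.aemeasurable) fun I c => ?_
  rw [hW.integral_cexp_sum Finset.univ c fun i : I => hX i,
    hW.integral_cexp_sum Finset.univ c fun i : I => hX' i]
  simp_rw [hcov]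

lemma ae_bounded_of_cov_eq (hW : IsWhiteNoise P ℱ W) {ι : Type*} [Countable ι]
    {h h' : ι → SpaceTime → ℝ} {X X' : ι → Ω → ℝ}
    (hX : ∀ i, HasWienerIntegral P W (h i) (X i))
    (hX' : ∀ i, HasWienerIntegral P W (h' i) (X' i))
    (hcov : ∀ i j, ∫ z, h i z * h j z ∂leb = ∫ z, h' i z * h' j z ∂leb)
    (hb : ∀ᵐ ω ∂P, ∃ K : ℕ, ∀ i, |X i ω| ≤ K) : ∀ᵐ ω ∂P, ∃ K : ℕ, ∀ i, |X' i ω| ≤ K := by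
  have hmeas : MeasurableSet {v : ι → ℝ | ∃ K : ℕ, ∀ i, |v i| ≤ K} := by
    simp only [Set.ofPred_exists, Set.ofPred_forall]
    exact MeasurableSet.iUnion fun K => MeasurableSet.iInter fun i =>
      measurableSet_le (by fun_prop) measurable_const
  have h := (ae_map_iff (aemeasurable_pi_iff.2 fun i => (hX i).2.1.1.aemeasurable) hmeas).2 hb
  rw [hW.map_eq_map hX hX' hcov] at h
  exact (ae_map_iff (aemeasurable_pi_iff.2 fun i => (hX' i).2.1.1.aemeasurable) hmeas).1 h

end IsWhiteNoise

end WienerIntegral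

section TimeShift

/-- Lebesgue measure on the time axis `[0, ∞)`, the first factor of `leb`. -/
noncomputable def timeMeasure : Measure ℝ≥0 :=
  Measure.comap (fun t : ℝ≥0 => (t : ℝ)) volume

lemma leb_eq_prod : leb = timeMeasure.prod volume := rfl

lemma measurableEmbedding_coe_nnreal : MeasurableEmbedding (fun t : ℝ≥0 => (t : ℝ)) :=
  MeasurableEmbedding.subtype_coe measurableSet_Ici

lemma measurePreserving_coe_timeMeasure :
    MeasurePreserving (fun t : ℝ≥0 => (t : ℝ)) timeMeasure (volume.restrict (Ici 0)) :=
  measurePreserving_subtype_coe measurableSet_Ici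

instance : SigmaFinite timeMeasure :=
  SigmaFinite.of_map _ measurableEmbedding_coe_nnreal.measurable.aemeasurable
    (by rw [measurePreserving_coe_timeMeasure.map_eq]; infer_instance)

lemma timeMeasure_apply (s : Set ℝ≥0) :
    timeMeasure s = volume ((fun t : ℝ≥0 => (t : ℝ)) '' s) :=
  measurableEmbedding_coe_nnreal.comap_apply _ _

lemma ae_timeMeasure_pos : ∀ᵐ s ∂timeMeasure, 0 < s := by
  simp [ae_iff, timeMeasure_apply]

lemma measurePreserving_add_timeMeasure (a : ℝ≥0) :
    MeasurePreserving (fun r => r + a) timeMeasure (timeMeasure.restrict (Ici a)) := by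
  refine ⟨by fun_prop, Measure.ext fun s hs => ?_⟩
  have preimage_eq : (fun t : ℝ≥0 => (t : ℝ)) '' ((fun r => r + a) ⁻¹' s) =
      (fun r : ℝ => r + a) ⁻¹' ((fun t : ℝ≥0 => (t : ℝ)) '' (s ∩ Ici a)) := by
    ext r
    simp only [mem_image, mem_preimage, mem_inter_iff, mem_Ici]
    constructor
    · rintro ⟨r, hr, rfl⟩
      exact ⟨r + a, ⟨hr, le_add_self⟩, by simp⟩
    · rintro ⟨w, ⟨hw, haw⟩, h⟩
      exact ⟨w - a, by rwa [tsub_add_cancel_of_le haw], by rw [NNReal.coe_sub haw, h]; ring⟩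
  rw [Measure.map_apply (by fun_prop) hs, Measure.restrict_apply hs, timeMeasure_apply,
    timeMeasure_apply, preimage_eq, measure_preimage_add_right]

/-- Translation of space-time by `a` in time. -/
def timeShift (a : ℝ≥0) (z : SpaceTime) : SpaceTime := (z.1 + a, z.2)

lemma measurableEmbedding_timeShift (a : ℝ≥0) : MeasurableEmbedding (timeShift a) := by
  have hcont : Continuous (timeShift a) := by unfold timeShift; fun_prop
  refine hcont.measurableEmbedding fun z w hzw => ?_
  simp only [timeShift, Prod.mk.injEq, add_left_inj] at hzw
  exact Prod.ext hzw.1 hzw.2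

lemma measurePreserving_timeShift (a : ℝ≥0) :
    MeasurePreserving (timeShift a) leb (leb.restrict (Ici a ×ˢ univ)) := by
  rw [leb_eq_prod, ← Measure.prod_restrict, Measure.restrict_univ]
  exact (measurePreserving_add_timeMeasure a).prod (MeasurePreserving.id _)

lemma shiftedKernel_timeShift (a t : ℝ≥0) (x : unitInterval) (z : SpaceTime) :
    shiftedKernel (t + a) x (timeShift a z) = shiftedKernel t x z := by
  simp [shiftedKernel, timeShift, indicator]

end TimeShift

section Forcing

lemma shiftedKernel_nonneg (t : ℝ≥0) (x : unitInterval) (z : SpaceTime) :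
    0 ≤ shiftedKernel t x z := by
  refine indicator_nonneg (fun z hz => dirichletHeatKernel_nonneg (sub_pos.2 ?_) x z.2) z
  exact NNReal.coe_lt_coe.2 hz.1

lemma abs_integral_shiftedKernel_slice_le {s t : ℝ≥0} (hst : s < t) (x : unitInterval)
    {f : unitInterval → ℝ} {M : ℝ} (hf : ∀ y, |f y| ≤ M) :
    |∫ y, shiftedKernel t x (s, y) * f y| ≤ M := by
  have kernel_eq (y : unitInterval) :
      shiftedKernel t x (s, y) = dirichletHeatKernel ((t : ℝ) - s) x y :=
    indicator_of_mem (by simpa using hst) _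
  simp_rw [kernel_eq]
  exact abs_integral_dirichletHeatKernel_mul_le (sub_pos.2 (NNReal.coe_lt_coe.2 hst)) x
    ((abs_nonneg _).trans (hf 0)) (Eventually.of_forall hf)

lemma integrable_indicator_Ioo_timeMeasure {φ : ℝ → ℝ} {t : ℝ≥0}
    (hφ : IntervalIntegrable φ volume 0 t) :
    Integrable (fun s : ℝ≥0 => (Ioo 0 (t : ℝ)).indicator φ s) timeMeasure := by
  have hφ' : IntegrableOn φ (Ioo 0 (t : ℝ)) :=
    ((intervalIntegrable_iff_integrableOn_Ioc_of_le t.2).1 hφ).mono_set Ioo_subset_Ioc_self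
  exact (measurePreserving_coe_timeMeasure.integrable_comp_emb measurableEmbedding_coe_nnreal).2
    (hφ'.integrable_indicator measurableSet_Ioo).integrableOn

lemma integral_indicator_Ioo_timeMeasure (φ : ℝ → ℝ) (t : ℝ≥0) :
    ∫ s : ℝ≥0, (Ioo 0 (t : ℝ)).indicator φ s ∂timeMeasure = ∫ s in (0 : ℝ)..t, φ s := by
  rw [measurePreserving_coe_timeMeasure.integral_comp measurableEmbedding_coe_nnreal,
    setIntegral_indicator measurableSet_Ioo,
    inter_eq_right.2 (Ioo_subset_Ioi_self.trans Ioi_subset_Ici_self),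
    intervalIntegral.integral_of_le t.coe_nonneg, integral_Ioc_eq_integral_Ioo]

lemma abs_integral_shiftedKernel_mul_le {t : ℝ≥0} {x : unitInterval} {f : SpaceTime → ℝ}
    {φ : ℝ → ℝ} (hf : ∀ s y, s ∈ Ioo 0 t → |f (s, y)| ≤ φ s)
    (hφ : IntervalIntegrable φ volume 0 t) :
    |∫ z, shiftedKernel t x z * f z ∂leb| ≤ ∫ s in (0 : ℝ)..t, φ s := by
  have slice_le : ∀ᵐ s ∂timeMeasure,
      ‖∫ y, shiftedKernel t x (s, y) * f (s, y)‖ ≤ (Ioo 0 (t : ℝ)).indicator φ s := by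
    filter_upwards [ae_timeMeasure_pos] with s hs
    by_cases hst : s < t
    · have hs_mem : (s : ℝ) ∈ Ioo 0 (t : ℝ) := ⟨NNReal.coe_pos.2 hs, NNReal.coe_lt_coe.2 hst⟩
      rw [indicator_of_mem hs_mem]
      exact abs_integral_shiftedKernel_slice_le hst x fun y => hf s y ⟨hs, hst⟩
    · rw [indicator_of_notMem fun h => hst (NNReal.coe_lt_coe.1 h.2)]
      have kernel_eq_zero (y : unitInterval) : shiftedKernel t x (s, y) = 0 :=
        indicator_of_notMem (by simpa using hst) _
      simp [kernel_eq_zero]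
  rw [← integral_indicator_Ioo_timeMeasure]
  by_cases hint : Integrable (fun z => shiftedKernel t x z * f z) leb
  · rw [leb_eq_prod] at hint ⊢
    rw [integral_prod _ hint]
    exact norm_integral_le_of_norm_le (integrable_indicator_Ioo_timeMeasure hφ) slice_le
  · rw [integral_undef hint, abs_zero]
    exact integral_nonneg_of_ae (slice_le.mono fun s hs => (norm_nonneg _).trans hs)

end Forcing

section Reflection

variable {Ω : Type*} {mΩ : MeasurableSpace Ω} {P : Measure Ω} {ℱ : Filtration ℝ≥0 mΩ}
  {W : Set SpaceTime → Ω → ℝ} {ι : Type*} [Countable ι]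

namespace IsWhiteNoise

lemma ae_bounded_indicator (hW : IsWhiteNoise P ℱ W) {S : Set SpaceTime}
    {h : ι → SpaceTime → ℝ} {V Z : ι → Ω → ℝ} (hV : ∀ i, HasWienerIntegral P W (h i) (V i))
    (hZ : ∀ i, HasWienerIntegral P W (S.indicator (h i)) (Z i))
    (hb : ∀ᵐ ω ∂P, ∃ K : ℕ, ∀ i, |V i ω| ≤ K) : ∀ᵐ ω ∂P, ∃ K : ℕ, ∀ i, |Z i ω| ≤ K := by
  -- Reflecting the noise in `S` preserves its law, so `∫ (h - 2 * 1_S * h) dW` is bounded as well.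
  have reflected_memLp (i : ι) : MemLp (fun z => h i z - 2 * S.indicator (h i) z) 2 leb :=
    (hV i).1.sub ((hZ i).1.const_mul 2)
  choose R hR using fun i => hW.exists_wienerIntegral (reflected_memLp i)
  have reflected_bounded : ∀ᵐ ω ∂P, ∃ K : ℕ, ∀ i, |R i ω| ≤ K := by
    refine hW.ae_bounded_of_cov_eq hV hR (fun i j => integral_congr_ae ?_) hb
    refine Eventually.of_forall fun z => ?_
    by_cases hz : z ∈ S
    · simp only [hz, indicator_of_mem]
      ring
    · simp [hz]
  have decomposition (i : ι) : ∀ᵐ ω ∂P, V i ω = R i ω + 2 * Z i ω :=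
    hW.ae_eq_add_const_mul (hV i) (hR i) (hZ i) fun z => by ring
  filter_upwards [hb, reflected_bounded, ae_all_iff.2 decomposition] with ω ⟨K, hK⟩ ⟨L, hL⟩ hω
  refine ⟨K + L, fun i => ?_⟩
  have := hω i
  have hVi := abs_le.1 (hK i)
  have hRi := abs_le.1 (hL i)
  push_cast
  exact abs_le.2 ⟨by linarith, by linarith⟩

lemma ae_bounded_of_timeShift (hW : IsWhiteNoise P ℱ W) {a : ℝ≥0} {h h' : ι → SpaceTime → ℝ}
    {X V : ι → Ω → ℝ} (hX : ∀ i, HasWienerIntegral P W (h i) (X i))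
    (hV : ∀ i, HasWienerIntegral P W (h' i) (V i)) (hh : ∀ i z, h' i (timeShift a z) = h i z)
    (hb : ∀ᵐ ω ∂P, ∃ K : ℕ, ∀ i, |V i ω| ≤ K) : ∀ᵐ ω ∂P, ∃ K : ℕ, ∀ i, |X i ω| ≤ K := by
  have hS : MeasurableSet (Ici a ×ˢ univ : Set SpaceTime) :=
    measurableSet_Ici.prod MeasurableSet.univ
  choose Z hZ using fun i => hW.exists_wienerIntegral ((hV i).1.indicator hS)
  refine hW.ae_bounded_of_cov_eq hZ hX (fun i j => ?_) (hW.ae_bounded_indicator hV hZ hb)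
  simp_rw [← hh, ← Set.inter_indicator_mul, Set.inter_self]
  rw [integral_indicator hS]
  exact ((measurePreserving_timeShift a).integral_comp (measurableEmbedding_timeShift a)
    fun z => h' i z * h' j z).symm

end IsWhiteNoise

end Reflection

section Osgood

lemma integral_inv_le_sub_of_hasDerivAt {B F ψ : ℝ → ℝ} {a t : ℝ} (hB : Continuous B)
    (hBpos : ∀ v, 0 < B v) (hat : a ≤ t) (hFc : ContinuousOn F (Icc a t))
    (hF : ∀ s ∈ Ioo a t, HasDerivAt F (ψ s) s) (hψ : ∀ s ∈ Ioo a t, ψ s ≤ B (F s)) :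
    ∫ v in F a..F t, (B v)⁻¹ ≤ t - a := by
  have inv_continuous : Continuous fun v => (B v)⁻¹ := hB.inv₀ fun v => (hBpos v).ne'
  set H : ℝ → ℝ := fun w => ∫ v in F a..w, (B v)⁻¹
  have hH (w : ℝ) : HasDerivAt H (B w)⁻¹ w :=
    (inv_continuous.integral_hasStrictDerivAt (F a) w).hasDerivAt
  have hHF (s : ℝ) (hs : s ∈ Ioo a t) : HasDerivAt (H ∘ F) ((B (F s))⁻¹ * ψ s) s :=
    (hH _).comp s (hF s hs)
  have hHc : Continuous H := continuous_iff_continuousAt.2 fun w => (hH w).continuousAt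
  have growth : H (F t) - H (F a) ≤ 1 * (t - a) := by
    refine (convex_Icc a t).image_sub_le_mul_sub_of_deriv_le (f := H ∘ F)
      (hHc.comp_continuousOn hFc) ?_ ?_ a (left_mem_Icc.2 hat) t (right_mem_Icc.2 hat) hat
    · rw [interior_Icc]
      exact fun s hs => (hHF s hs).differentiableAt.differentiableWithinAt
    · rw [interior_Icc]
      intro s hs
      rw [(hHF s hs).deriv, inv_mul_le_one₀ (hBpos _)]
      exact hψ s hs
  simpa [H] using growth

lemma add_integral_le_of_lt_integral_inv {B φ : ℝ → ℝ} {A K T : ℝ} (hB : Continuous B)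
    (hBpos : ∀ v, 0 < B v) (hBm : Monotone B) (hφc : ContinuousOn φ (Ioo 0 T))
    (hφi : IntervalIntegrable (fun s => B (φ s)) volume 0 T)
    (hφ : ∀ t ∈ Ioo 0 T, φ t ≤ A + ∫ s in (0 : ℝ)..t, B (φ s))
    (hK : T < ∫ v in A..K, (B v)⁻¹) {t : ℝ} (ht : t ∈ Ioo 0 T) :
    A + ∫ s in (0 : ℝ)..t, B (φ s) ≤ K := by
  set F : ℝ → ℝ := fun t => A + ∫ s in (0 : ℝ)..t, B (φ s) with hF
  have Bφ_continuousOn : ContinuousOn (fun s => B (φ s)) (Ioo 0 T) := hB.comp_continuousOn hφc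
  have hφi_le {s : ℝ} (hs : s ∈ Ioo 0 T) : IntervalIntegrable (fun s => B (φ s)) volume 0 s :=
    hφi.mono_set (by
      rw [uIcc_of_le hs.1.le, uIcc_of_le (hs.1.trans hs.2).le]
      exact Icc_subset_Icc_right hs.2.le)
  have F_deriv {s : ℝ} (hs : s ∈ Ioo 0 T) : HasDerivAt F (B (φ s)) s :=
    HasDerivAt.const_add A (intervalIntegral.integral_hasDerivAt_right (hφi_le hs)
      (Bφ_continuousOn.stronglyMeasurableAtFilter isOpen_Ioo s hs)
      ((Bφ_continuousOn s hs).continuousAt (Ioo_mem_nhds hs.1 hs.2)))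
  have F_continuousOn : ContinuousOn F (Icc 0 t) := by
    have := intervalIntegral.continuousOn_primitive_interval' (hφi_le ht) left_mem_uIcc
    rw [uIcc_of_le ht.1.le] at this
    exact continuousOn_const.add this
  have separation : ∫ v in A..F t, (B v)⁻¹ ≤ t := by
    have := integral_inv_le_sub_of_hasDerivAt hB hBpos ht.1.le F_continuousOn
      (fun s hs => F_deriv ⟨hs.1, hs.2.trans ht.2⟩)
      fun s hs => hBm (hφ s ⟨hs.1, hs.2.trans ht.2⟩)
    simpa [hF] using this
  by_contra! hlt
  have inv_continuous : Continuous fun v => (B v)⁻¹ := hB.inv₀ fun v => (hBpos v).ne'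
  have hsplit := intervalIntegral.integral_add_adjacent_intervals
    (inv_continuous.intervalIntegrable (μ := volume) A K)
    (inv_continuous.intervalIntegrable K (F t))
  have := intervalIntegral.integral_nonneg (μ := volume) hlt.le
    fun v (_ : v ∈ Icc K (F t)) => (inv_pos.2 (hBpos v)).le
  linarith [ht.2]

lemma exists_lt_intervalIntegral {f : ℝ → ℝ} (hf : LocallyIntegrable f) (hf0 : ∀ v, 0 ≤ f v)
    {A : ℝ} (htop : ∫⁻ v in Ioi A, ENNReal.ofReal (f v) = ∞) (T : ℝ) :
    ∃ K, T < ∫ v in A..K, f v := by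
  by_contra! hbound
  have hint : IntegrableOn f (Ioi A) := by
    refine integrableOn_Ioi_of_intervalIntegral_norm_bounded (l := atTop) (b := id) T A
      (fun K => (hf.integrableOn_isCompact isCompact_Icc).mono_set Ioc_subset_Icc_self) tendsto_id
      (Eventually.of_forall fun K => ?_)
    simpa only [Real.norm_of_nonneg (hf0 _), id] using hbound K
  exact ((hasFiniteIntegral_iff_ofReal (Eventually.of_forall hf0)).1 hint.2).ne htop

lemma exists_le_of_osgoodCondition_add_const {b : ℝ → ℝ} {c : ℝ}
    (h : OsgoodCondition fun v => c + b v) : ∃ s > 0, c ≤ b s := by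
  by_contra! hlt
  obtain ⟨a, ha, hfin⟩ := h
  have hconst : ∫⁻ _ in Ioi a, (ENNReal.ofReal (c + c))⁻¹ ≤
      ∫⁻ s in Ioi a, (ENNReal.ofReal (c + b s))⁻¹ := by
    refine setLIntegral_mono' measurableSet_Ioi fun s hs => ?_
    gcongr
    exact (hlt s (ha.trans hs)).le
  rw [setLIntegral_const, Real.volume_Ioi, ENNReal.mul_top (by simp)] at hconst
  exact hfin.ne (top_le_iff.1 hconst)

lemma osgoodCondition_of_add_const {b : ℝ → ℝ} (hb : MonotoneOn b (Ioi 0)) {c : ℝ} (hc : 0 < c)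
    (h : OsgoodCondition fun v => c + b v) : OsgoodCondition b := by
  obtain ⟨s₀, hs₀, hcs₀⟩ := exists_le_of_osgoodCondition_add_const h
  obtain ⟨a, _, hfin⟩ := h
  refine ⟨max s₀ a, lt_max_of_lt_left hs₀, ?_⟩
  calc ∫⁻ s in Ioi (max s₀ a), (ENNReal.ofReal (b s))⁻¹
      ≤ ∫⁻ s in Ioi (max s₀ a), 2 * (ENNReal.ofReal (c + b s))⁻¹ := by
        refine setLIntegral_mono' measurableSet_Ioi fun s hs => ?_
        have hs₀s : s₀ < s := (le_max_left _ _).trans_lt hs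
        have hcs : c ≤ b s := hcs₀.trans (hb hs₀ (hs₀.trans hs₀s) hs₀s.le)
        rw [← ENNReal.ofReal_inv_of_pos (by linarith), ← ENNReal.ofReal_inv_of_pos (by linarith),
          ← ENNReal.ofReal_ofNat, ← ENNReal.ofReal_mul (by norm_num)]
        refine ENNReal.ofReal_le_ofReal ?_
        rw [← div_eq_mul_inv, inv_eq_one_div, div_le_div_iff₀ (by linarith) (by linarith)]
        linarith
    _ = 2 * ∫⁻ s in Ioi (max s₀ a), (ENNReal.ofReal (c + b s))⁻¹ :=
        lintegral_const_mul' _ _ (by norm_num)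
    _ ≤ 2 * ∫⁻ s in Ioi a, (ENNReal.ofReal (c + b s))⁻¹ := by
        gcongr
        exact le_max_right _ _
    _ < ∞ := ENNReal.mul_lt_top (by norm_num) hfin

lemma exists_lt_integral_inv_of_not_osgoodCondition {b : ℝ → ℝ} (hb0 : ∀ v, 0 ≤ b v)
    (hbc : Continuous b) (hbm : MonotoneOn b (Ioi 0)) (hO : ¬ OsgoodCondition b) {c : ℝ}
    (hc : 0 < c) (A T : ℝ) : ∃ K, T < ∫ v in A..K, (c + b (max v 0))⁻¹ := by
  have hpos (v : ℝ) : 0 < c + b (max v 0) := by linarith [hb0 (max v 0)]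
  have hcont : Continuous fun v => (c + b (max v 0))⁻¹ :=
    Continuous.inv₀ (by fun_prop) fun v => (hpos v).ne'
  refine exists_lt_intervalIntegral hcont.locallyIntegrable (fun v => (inv_pos.2 (hpos v)).le)
    (not_lt_top_iff.1 fun hfin => ?_) T
  refine hO (osgoodCondition_of_add_const hbm hc ⟨max A 1, by simp, hfin.trans_le' ?_⟩)
  refine (setLIntegral_mono' measurableSet_Ioi fun v hv => ?_).trans
    (lintegral_mono_set (Ioi_subset_Ioi (le_max_left A 1)))
  have hv0 : 0 ≤ v := zero_le_one.trans ((le_max_right A 1).trans hv.le)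
  rw [ENNReal.ofReal_inv_of_pos (hpos v), max_eq_left hv0]

end Osgood

section Paths

lemma le_of_dense_of_le {X : Type*} [TopologicalSpace X] {U D : Set X} (hU : IsOpen U)
    (hD : Dense D) {f g : X → ℝ} (hf : ContinuousOn f U) (hg : ContinuousOn g U)
    (h : ∀ z ∈ D, z ∈ U → f z ≤ g z) {z : X} (hz : z ∈ U) : f z ≤ g z :=
  ContinuousWithinAt.closure_le (hD.open_subset_closure_inter hU hz)
    ((hf z hz).mono inter_subset_left) ((hg z hz).mono inter_subset_left)
    fun w hw => h w hw.2 hw.1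

/-- The largest value of `v(s, ·)` on `[0, 1]`. Time is a real number, so that `spatialSup v` can
be integrated over intervals; at negative times it takes the value at time `0`. -/
noncomputable def spatialSup (v : SpaceTime → ℝ) (s : ℝ) : ℝ :=
  ⨆ x : unitInterval, v (s.toNNReal, x)

lemma toNNReal_mem_Ioo {s : ℝ} {T : ℝ≥0} (hs : s ∈ Ioo 0 (T : ℝ)) : s.toNNReal ∈ Ioo 0 T :=
  ⟨Real.toNNReal_pos.2 hs.1, (Real.toNNReal_lt_iff_lt_coe hs.1.le).2 hs.2⟩

lemma continuousOn_spatialSup {v : SpaceTime → ℝ} {T : ℝ≥0}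
    (hv : ContinuousOn v (Ioo 0 T ×ˢ univ)) :
    ContinuousOn (spatialSup v) (Ioo 0 (T : ℝ)) := by
  rw [continuousOn_iff_continuous_domRestrict]
  have hcont : Continuous fun p : Ioo 0 (T : ℝ) × unitInterval => v ((p.1 : ℝ).toNNReal, p.2) :=
    hv.comp_continuous (by fun_prop) fun p => ⟨toNNReal_mem_Ioo p.1.2, mem_univ _⟩
  have hsup := isCompact_univ.continuous_sSup
    (f := fun (s : Ioo 0 (T : ℝ)) x => v ((s : ℝ).toNNReal, x)) hcont
  simp only [image_univ] at hsup
  exact hsup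

lemma le_spatialSup {v : SpaceTime → ℝ} {T : ℝ≥0} (hv : ContinuousOn v (Ioo 0 T ×ˢ univ))
    {z : SpaceTime} (hz : z.1 ∈ Ioo 0 T) : v z ≤ spatialSup v z.1 := by
  have hslice : Continuous fun x : unitInterval => v (z.1, x) :=
    hv.comp_continuous (by fun_prop) fun x => ⟨hz, mem_univ x⟩
  rw [spatialSup, Real.toNNReal_coe]
  exact le_ciSup (isCompact_range hslice).bddAbove z.2

/-- `v` is a continuous path on `(0, T) × [0, 1]` of the mild equation with drift `g`, in which the
initial and noise terms are known only through their sum being at most `A` in absolute value.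
This is asked for at the points of a dense set, as a mild solution satisfies the equation almost
surely on any given countable set only. -/
structure IsMildPath (g : ℝ → ℝ) (A : ℝ) (T : ℝ≥0) (v : SpaceTime → ℝ) : Prop where
  continuousOn : ContinuousOn v (Ioo 0 T ×ˢ univ)
  dense_abs_sub_le : Dense {z : SpaceTime | z.1 ∈ Ioo 0 T →
    |v z - ∫ z', shiftedKernel z.1 z.2 z' * g (v z') ∂leb| ≤ A}

namespace IsMildPath

variable {g : ℝ → ℝ} {A : ℝ} {T : ℝ≥0} {v : SpaceTime → ℝ}

lemma neg_le (hv : IsMildPath g A T v) (hg : ∀ w, 0 ≤ g w) {z : SpaceTime} (hz : z.1 ∈ Ioo 0 T) :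
    -A ≤ v z := by
  refine le_of_dense_of_le (isOpen_Ioo.prod isOpen_univ) hv.dense_abs_sub_le
    (f := fun _ => -A) continuousOn_const hv.continuousOn (fun w hwD hw => ?_) ⟨hz, mem_univ z.2⟩
  have drift_nonneg : 0 ≤ ∫ z', shiftedKernel w.1 w.2 z' * g (v z') ∂leb :=
    integral_nonneg fun z' => mul_nonneg (shiftedKernel_nonneg _ _ _) (hg _)
  linarith [(abs_le.1 (hwD hw.1)).1]

lemma le_add_integral (hv : IsMildPath g A T v) {φ : ℝ → ℝ} (hφ : IntervalIntegrable φ volume 0 T)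
    (hgφ : ∀ z : SpaceTime, z.1 ∈ Ioo 0 T → |g (v z)| ≤ φ z.1) {z : SpaceTime}
    (hz : z.1 ∈ Ioo 0 T) : v z ≤ A + ∫ s in (0 : ℝ)..z.1, φ s := by
  have primitive_continuousOn :
      ContinuousOn (fun w : SpaceTime => A + ∫ s in (0 : ℝ)..w.1, φ s) (Ioo 0 T ×ˢ univ) := by
    refine continuousOn_const.add ((intervalIntegral.continuousOn_primitive_interval' hφ
      left_mem_uIcc).comp (f := fun w : SpaceTime => (w.1 : ℝ)) (by fun_prop) fun w hw => ?_)
    rw [uIcc_of_le T.coe_nonneg]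
    exact ⟨w.1.coe_nonneg, NNReal.coe_le_coe.2 hw.1.2.le⟩
  refine le_of_dense_of_le (isOpen_Ioo.prod isOpen_univ) hv.dense_abs_sub_le hv.continuousOn
    primitive_continuousOn (fun w hwD hw => ?_) ⟨hz, mem_univ z.2⟩
  have hφw : IntervalIntegrable φ volume 0 w.1 := hφ.mono_set (by
    rw [uIcc_of_le T.coe_nonneg, uIcc_of_le w.1.coe_nonneg]
    exact Icc_subset_Icc_right (NNReal.coe_le_coe.2 hw.1.2.le))
  have drift_le := abs_integral_shiftedKernel_mul_le (x := w.2) (f := fun z' => g (v z'))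
    (fun s y hs => hgφ (s, y) ⟨hs.1, hs.2.trans hw.1.2⟩) hφw
  linarith [(abs_le.1 (hwD hw.1)).2, (abs_le.1 drift_le).2]

lemma le_add_mul (hv : IsMildPath g A T v) {C : ℝ} (hg : ∀ w, |g w| ≤ C) {z : SpaceTime}
    (hz : z.1 ∈ Ioo 0 T) : v z ≤ A + T * C := by
  have hC : 0 ≤ C := (abs_nonneg _).trans (hg 0)
  calc v z ≤ A + ∫ _ in (0 : ℝ)..z.1, C :=
        hv.le_add_integral intervalIntegrable_const (fun _ _ => hg _) hz
    _ = A + z.1 * C := by simp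
    _ ≤ A + T * C := by gcongr; exact hz.2.le

variable {B : ℝ → ℝ}

lemma intervalIntegrable_comp_spatialSup (hv : IsMildPath g A T v) {C : ℝ}
    (hgC : ∀ w, |g w| ≤ C) (hB : Continuous B) (hB0 : ∀ w, 0 ≤ B w) (hBm : Monotone B) :
    IntervalIntegrable (fun s => B (spatialSup v s)) volume 0 T := by
  rw [intervalIntegrable_iff_integrableOn_Ioo_of_le T.coe_nonneg]
  refine Integrable.of_bound ((hB.comp_continuousOn
    (continuousOn_spatialSup hv.continuousOn)).aestronglyMeasurable measurableSet_Ioo)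
    (B (A + T * C)) ?_
  filter_upwards [ae_restrict_mem measurableSet_Ioo] with s hs
  rw [Real.norm_of_nonneg (hB0 _)]
  exact hBm (ciSup_le fun x => hv.le_add_mul hgC (toNNReal_mem_Ioo hs))

lemma mem_Icc (hv : IsMildPath g A T v) {C K : ℝ} (hg0 : ∀ w, 0 ≤ g w) (hgC : ∀ w, g w ≤ C)
    (hgB : ∀ w, -A ≤ w → g w ≤ B w) (hB : Continuous B) (hBpos : ∀ w, 0 < B w)
    (hBm : Monotone B) (hK : (T : ℝ) < ∫ w in A..K, (B w)⁻¹) {z : SpaceTime}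
    (hz : z.1 ∈ Ioo 0 T) : v z ∈ Icc (-A) K := by
  have hgC' (w : ℝ) : |g w| ≤ C := (abs_of_nonneg (hg0 w)).trans_le (hgC w)
  have hint := hv.intervalIntegrable_comp_spatialSup hgC' hB (fun w => (hBpos w).le) hBm
  have le_primitive {w : SpaceTime} (hw : w.1 ∈ Ioo 0 T) :
      v w ≤ A + ∫ s in (0 : ℝ)..w.1, B (spatialSup v s) := by
    refine hv.le_add_integral hint (fun w hw => ?_) hw
    calc |g (v w)| = g (v w) := abs_of_nonneg (hg0 _)
      _ ≤ B (v w) := hgB _ (hv.neg_le hg0 hw)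
      _ ≤ B (spatialSup v w.1) := hBm (le_spatialSup hv.continuousOn hw)
  have spatialSup_le (s : ℝ) (hs : s ∈ Ioo 0 (T : ℝ)) :
      spatialSup v s ≤ A + ∫ r in (0 : ℝ)..s, B (spatialSup v r) :=
    ciSup_le fun x => by
      simpa only [Real.coe_toNNReal s hs.1.le] using
        le_primitive (w := (s.toNNReal, x)) (toNNReal_mem_Ioo hs)
  exact ⟨hv.neg_le hg0 hz, (le_primitive hz).trans (add_integral_le_of_lt_integral_inv hB hBpos hBm
    (continuousOn_spatialSup hv.continuousOn) hint spatialSup_le hK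
    ⟨NNReal.coe_pos.2 hz.1, NNReal.coe_lt_coe.2 hz.2⟩)⟩

end IsMildPath

end Paths

section Truncation

variable {b : ℝ → ℝ}

lemma truncateDrift_nonneg (hb : ∀ x, 0 ≤ b x) (N : ℕ) (x : ℝ) : 0 ≤ truncateDrift b N x := by
  unfold truncateDrift
  split_ifs <;> exact hb _

lemma exists_truncateDrift_le (hb : Continuous b) (N : ℕ) : ∃ C, ∀ x, truncateDrift b N x ≤ C := by
  obtain ⟨C, hC⟩ := (isCompact_Icc (a := -(N : ℝ)) (b := N)).bddAbove_image hb.continuousOn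
  have hbC (x : ℝ) (hx : x ∈ Icc (-(N : ℝ)) N) : b x ≤ C := hC (mem_image_of_mem b hx)
  have hN : -(N : ℝ) ≤ N := neg_le_self N.cast_nonneg
  refine ⟨C, fun x => ?_⟩
  unfold truncateDrift
  split_ifs with hx
  · exact hbC x (abs_le.1 hx)
  · exact hbC _ (right_mem_Icc.2 hN)
  · exact hbC _ (left_mem_Icc.2 hN)

lemma truncateDrift_le (hb0 : ∀ x, 0 ≤ b x) (hbm : MonotoneOn b (Ioi 0)) {A C : ℝ} (hC0 : 0 ≤ C)
    (hC : ∀ x ∈ Icc (-A) 0, b x ≤ C) {N : ℕ} (hN : 1 ≤ N) {x : ℝ} (hx : -A ≤ x) :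
    truncateDrift b N x ≤ C + b (max x 0) := by
  have hN' : (0 : ℝ) < N := by exact_mod_cast hN
  have hb_max := hb0 (max x 0)
  unfold truncateDrift
  split_ifs with habs hNx
  · rcases le_or_gt x 0 with hx0 | hx0
    · linarith [hC x ⟨hx, hx0⟩]
    · rw [max_eq_left hx0.le]
      linarith
  · have hx0 : 0 < x := hN'.trans hNx
    rw [max_eq_left hx0.le]
    linarith [hbm hN' hx0 hNx.le]
  · have hxN : x < -N := not_le.1 fun h => habs (abs_le.2 ⟨h, not_lt.1 hNx⟩)
    linarith [hC (-N) ⟨by linarith, by linarith⟩]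

lemma monotone_comp_max_zero (hb : Continuous b) (hbm : MonotoneOn b (Ioi 0)) :
    Monotone fun v : ℝ => b (max v 0) := by
  have hIci : MonotoneOn b (Ici 0) := by
    rw [← Ioi_insert]
    exact hbm.insert_of_continuousWithinAt (mem_closure_iff_clusterPt.1 (by simp))
      hb.continuousWithinAt
  exact fun v w hvw => hIci (le_max_right v 0) (le_max_right w 0) (max_le_max_right 0 hvw)

end Truncation

section BlowUp

variable {Ω : Type*} {mΩ : MeasurableSpace Ω} {P : Measure Ω} {ℱ : Filtration ℝ≥0 mΩ}
  {W : Set SpaceTime → Ω → ℝ} {σ M : ℝ} {u₀ : unitInterval → ℝ}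

namespace IsGlobalSolution

variable {g : ℝ → ℝ} {v : ℝ≥0 → unitInterval → Ω → ℝ}

lemma ae_eq_of_hasWienerIntegral (hv : IsGlobalSolution P ℱ W g σ u₀ v) (hW : IsWhiteNoise P ℱ W)
    {t : ℝ≥0} {x : unitInterval} (ht : 0 < t) {X : Ω → ℝ}
    (hX : HasWienerIntegral P W (shiftedKernel t x) X) :
    ∀ᵐ ω ∂P, v t x ω = (∫ y : unitInterval, dirichletHeatKernel t x y * u₀ y)
      + (∫ z, shiftedKernel t x z * g (v z.1 z.2 ω) ∂leb) + σ * X ω := by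
  obtain ⟨Y, hY, hmild⟩ := hv.mild t x ht
  filter_upwards [hmild, hW.wienerIntegral_unique hY hX] with ω hω hYX
  rw [← hYX]
  exact hω.2

lemma ae_bounded_noise_of_one_le (hv : IsGlobalSolution P ℱ W g σ u₀ v) (hW : IsWhiteNoise P ℱ W)
    {C : ℝ} (hg : ∀ w, |g w| ≤ C) (hM : 0 ≤ M) (hu₀ : ∀ᵐ y, |u₀ y| ≤ M) {ι : Type*} [Countable ι]
    {z : ι → SpaceTime} {T : ℝ≥0} (hz : ∀ i, (z i).1 ∈ Icc 1 T) {X : ι → Ω → ℝ}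
    (hX : ∀ i, HasWienerIntegral P W (shiftedKernel (z i).1 (z i).2) (X i)) :
    ∀ᵐ ω ∂P, ∃ K : ℕ, ∀ i, |σ * X i ω| ≤ K := by
  have hpos (i : ι) : 0 < (z i).1 := zero_lt_one.trans_le (hz i).1
  have hC : 0 ≤ C := (abs_nonneg _).trans (hg 0)
  filter_upwards [hv.continuous,
    ae_all_iff.2 fun i => hv.ae_eq_of_hasWienerIntegral hW (hpos i) (hX i)] with ω hcont hmild
  obtain ⟨L, hL⟩ := (isCompact_Icc.prod isCompact_univ).exists_bound_of_continuousOn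
    (hcont.mono (prod_mono (s₁ := Icc 1 T) (fun s hs => zero_lt_one.trans_le hs.1) Subset.rfl))
  obtain ⟨K, hK⟩ := exists_nat_ge (L + M + T * C)
  refine ⟨K, fun i => le_trans ?_ hK⟩
  have initial_le := abs_integral_dirichletHeatKernel_mul_le (NNReal.coe_pos.2 (hpos i)) (z i).2
    hM hu₀
  have drift_le : |∫ w, shiftedKernel (z i).1 (z i).2 w * g (v w.1 w.2 ω) ∂leb| ≤ T * C :=
    calc _ ≤ ∫ _ in (0 : ℝ)..(z i).1, C :=
          abs_integral_shiftedKernel_mul_le (fun _ _ _ => hg _) intervalIntegrable_const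
      _ = (z i).1 * C := by simp
      _ ≤ T * C := by gcongr; exact (hz i).2
  have path_le : |v (z i).1 (z i).2 ω| ≤ L := hL (z i) ⟨hz i, mem_univ _⟩
  rw [abs_le] at initial_le drift_le path_le ⊢
  have := hmild i
  constructor <;> linarith

lemma ae_bounded_noise (hv : IsGlobalSolution P ℱ W g σ u₀ v) (hW : IsWhiteNoise P ℱ W)
    {C : ℝ} (hg : ∀ w, |g w| ≤ C) (hM : 0 ≤ M) (hu₀ : ∀ᵐ y, |u₀ y| ≤ M) {ι : Type*} [Countable ι]
    {z : ι → SpaceTime} {T : ℝ≥0} (hz : ∀ i, (z i).1 ≤ T) {X : ι → Ω → ℝ}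
    (hX : ∀ i, HasWienerIntegral P W (shiftedKernel (z i).1 (z i).2) (X i)) :
    ∀ᵐ ω ∂P, ∃ K : ℕ, ∀ i, |σ * X i ω| ≤ K := by
  -- The solution is controlled only away from time `0`, hence the passage through time `t + 1`.
  rcases eq_or_ne σ 0 with rfl | hσ
  · exact Eventually.of_forall fun ω => ⟨0, by simp⟩
  choose V hV _ using fun i => hv.mild ((z i).1 + 1) (z i).2 (by simp)
  have shifted_bounded : ∀ᵐ ω ∂P, ∃ K : ℕ, ∀ i, |V i ω| ≤ K := by
    filter_upwards [hv.ae_bounded_noise_of_one_le hW hg hM hu₀ (z := fun i => timeShift 1 (z i))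
      (T := T + 1) (fun i => ⟨le_add_self, add_le_add_left (hz i) 1⟩) hV] with ω ⟨K, hK⟩
    obtain ⟨L, hL⟩ := exists_nat_ge (K / |σ|)
    refine ⟨L, fun i => le_trans ?_ hL⟩
    rw [le_div_iff₀' (abs_pos.2 hσ), ← abs_mul]
    exact hK i
  filter_upwards [hW.ae_bounded_of_timeShift hX hV
    (fun i => shiftedKernel_timeShift 1 (z i).1 (z i).2) shifted_bounded] with ω ⟨K, hK⟩
  obtain ⟨L, hL⟩ := exists_nat_ge (|σ| * K)
  refine ⟨L, fun i => le_trans ?_ hL⟩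
  rw [abs_mul]
  exact mul_le_mul_of_nonneg_left (hK i) (abs_nonneg σ)

lemma ae_isMildPath (hv : IsGlobalSolution P ℱ W g σ u₀ v) (hW : IsWhiteNoise P ℱ W)
    (hM : 0 ≤ M) (hu₀ : ∀ᵐ y, |u₀ y| ≤ M) {D : Set SpaceTime} (hDc : D.Countable) (hD : Dense D)
    {T : ℝ≥0} {X : SpaceTime → Ω → ℝ}
    (hX : ∀ z : SpaceTime, 0 < z.1 → HasWienerIntegral P W (shiftedKernel z.1 z.2) (X z)) :
    ∀ᵐ ω ∂P, ∀ K : ℝ, (∀ z ∈ D, z.1 ∈ Ioo 0 T → |σ * X z ω| ≤ K) →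
      IsMildPath g (M + K) T fun z => v z.1 z.2 ω := by
  have hmild : ∀ᵐ ω ∂P, ∀ z ∈ D, 0 < z.1 →
      v z.1 z.2 ω = (∫ y : unitInterval, dirichletHeatKernel z.1 z.2 y * u₀ y)
        + (∫ w, shiftedKernel z.1 z.2 w * g (v w.1 w.2 ω) ∂leb) + σ * X z ω := by
    refine (ae_ball_iff hDc).2 fun z _ => ?_
    by_cases hz : 0 < z.1
    · filter_upwards [hv.ae_eq_of_hasWienerIntegral hW hz (hX z hz)] with ω hω _ using hω
    · exact Eventually.of_forall fun ω h => absurd h hz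
  filter_upwards [hmild, hv.continuous] with ω hω hcont K hK
  refine ⟨hcont.mono (prod_mono Ioo_subset_Ioi_self Subset.rfl), hD.mono fun z hzD hz => ?_⟩
  have initial_le := abs_integral_dirichletHeatKernel_mul_le (NNReal.coe_pos.2 hz.1) z.2 hM hu₀
  rw [hω z hzD hz.1, add_right_comm, add_sub_cancel_right]
  exact (abs_add_le _ _).trans (add_le_add initial_le (hK z hzD hz))

end IsGlobalSolution

lemma ae_exists_forall_isMildPath (hW : IsWhiteNoise P ℱ W) (hu₀ : MemLp u₀ ∞) {κ : Type*}
    [Countable κ] {g : κ → ℝ → ℝ} {u : κ → ℝ≥0 → unitInterval → Ω → ℝ}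
    (hu : ∀ k, IsGlobalSolution P ℱ W (g k) σ u₀ (u k)) {k₀ : κ} {C : ℝ}
    (hg : ∀ w, |g k₀ w| ≤ C) (T : ℝ≥0) :
    ∀ᵐ ω ∂P, ∃ A, 0 ≤ A ∧ ∀ k, IsMildPath (g k) A T fun z => u k z.1 z.2 ω := by
  have hM : ∀ᵐ y, |u₀ y| ≤ lpNorm u₀ ∞ volume := ae_le_lpNorm_exponent_top hu₀
  obtain ⟨D, hDc, hD⟩ := TopologicalSpace.exists_countable_dense SpaceTime
  choose! X hX _ using fun z : SpaceTime => (hu k₀).mild z.1 z.2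
  have : Countable {z : SpaceTime // z ∈ D ∧ z.1 ∈ Ioo 0 T} :=
    (hDc.mono fun z hz => hz.1).to_subtype
  filter_upwards [ae_all_iff.2 fun k => (hu k).ae_isMildPath hW lpNorm_nonneg hM hDc hD hX,
    (hu k₀).ae_bounded_noise hW hg lpNorm_nonneg hM
      (z := ((↑) : {z : SpaceTime // z ∈ D ∧ z.1 ∈ Ioo 0 T} → SpaceTime))
      (fun z => z.2.2.2.le) fun z => hX z z.2.2.1] with ω hpath ⟨K, hK⟩
  exact ⟨lpNorm u₀ ∞ volume + K, add_nonneg lpNorm_nonneg K.cast_nonneg,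
    fun k => hpath k K fun z hzD hz => hK ⟨z, hzD, hz⟩⟩

lemma le_exitTime {v : ℝ≥0 → unitInterval → Ω → ℝ} {T : ℝ≥0} {N : ℕ} {ω : Ω}
    (hv : ∀ t ∈ Ioo 0 T, ∀ x, |v t x ω| ≤ N) : (T : ℝ≥0∞) ≤ exitTime v N ω := by
  refine le_iInf₂ fun t ⟨ht, hN⟩ => ?_
  by_contra! htT
  refine hN.not_ge (iSup_le fun x => ?_)
  rw [Real.enorm_eq_ofReal_abs]
  exact ENNReal.ofReal_le_natCast.2 (hv t ⟨ht, ENNReal.coe_lt_coe.1 htT⟩ x)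

variable {b : ℝ → ℝ} {u : ℕ → ℝ≥0 → unitInterval → Ω → ℝ}

lemma le_blowupTime_of_isMildPath (hb0 : ∀ x, 0 ≤ b x) (hbc : Continuous b)
    (hbm : MonotoneOn b (Ioi 0)) (hO : ¬ OsgoodCondition b) {A : ℝ} (hA : 0 ≤ A) {T : ℝ≥0} {ω : Ω}
    (hu : ∀ N, 1 ≤ N → IsMildPath (truncateDrift b N) A T fun z => u N z.1 z.2 ω) :
    (T : ℝ≥0∞) ≤ blowupTime u ω := by
  obtain ⟨c, hc⟩ := (isCompact_Icc (a := -A) (b := 0)).bddAbove_image hbc.continuousOn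
  have b_le (x : ℝ) (hx : x ∈ Icc (-A) 0) : b x ≤ c := hc (mem_image_of_mem b hx)
  have hc0 : 0 ≤ c := (hb0 0).trans (b_le 0 ⟨neg_nonpos.2 hA, le_rfl⟩)
  obtain ⟨K, hK⟩ :=
    exists_lt_integral_inv_of_not_osgoodCondition hb0 hbc hbm hO (c := c + 1) (by linarith) A T
  obtain ⟨N, hN⟩ := exists_nat_ge (max (max K A) 1)
  simp only [max_le_iff, Nat.one_le_cast] at hN
  obtain ⟨⟨hKN, hAN⟩, hN1⟩ := hN
  obtain ⟨C, hC⟩ := exists_truncateDrift_le hbc N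
  have drift_le (w : ℝ) (hw : -A ≤ w) : truncateDrift b N w ≤ c + 1 + b (max w 0) := by
    linarith [truncateDrift_le hb0 hbm hc0 b_le hN1 hw]
  calc (T : ℝ≥0∞) ≤ exitTime (u N) N ω := le_exitTime fun t ht x => by
        have hmem := (hu N hN1).mem_Icc (truncateDrift_nonneg hb0 N) hC drift_le (by fun_prop)
          (fun w => by linarith [hb0 (max w 0)])
          ((monotone_comp_max_zero hbc hbm).const_add (c + 1)) hK (z := (t, x)) ht
        exact abs_le.2 ⟨by linarith [hmem.1], hmem.2.trans hKN⟩
    _ ≤ blowupTime u ω := le_iSup₂ (f := fun N _ => exitTime (u N) N ω) N hN1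

lemma ae_blowupTime_eq_top (hW : IsWhiteNoise P ℱ W) (hb0 : ∀ x, 0 ≤ b x) (hbc : Continuous b)
    (hbm : MonotoneOn b (Ioi 0)) (hO : ¬ OsgoodCondition b) (hu₀ : MemLp u₀ ∞)
    (hu : ∀ N, 1 ≤ N → IsGlobalSolution P ℱ W (truncateDrift b N) σ u₀ (u N)) :
    ∀ᵐ ω ∂P, blowupTime u ω = ∞ := by
  obtain ⟨C, hC⟩ := exists_truncateDrift_le hbc 1
  have abs_drift_le (w : ℝ) : |truncateDrift b 1 w| ≤ C :=
    (abs_of_nonneg (truncateDrift_nonneg hb0 1 w)).trans_le (hC w)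
  have le_blowupTime (T : ℕ) : ∀ᵐ ω ∂P, (T : ℝ≥0∞) ≤ blowupTime u ω := by
    filter_upwards [ae_exists_forall_isMildPath hW hu₀ (fun N : {N : ℕ // 1 ≤ N} => hu N N.2)
      (k₀ := ⟨1, le_rfl⟩) abs_drift_le T] with ω ⟨A, hA, hpath⟩
    exact_mod_cast le_blowupTime_of_isMildPath hb0 hbc hbm hO hA fun N hN => hpath ⟨N, hN⟩
  filter_upwards [ae_all_iff.2 le_blowupTime] with ω hω
  exact ENNReal.eq_top_of_forall_nnreal_le fun r =>
    (ENNReal.coe_le_coe.2 (Nat.le_ceil r)).trans (by exact_mod_cast hω ⌈r⌉₊)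

end BlowUp

end OsgoodSPDE

theorem mainTheorem1_general {Ω : Type*} {mΩ : MeasurableSpace Ω} (P : Measure Ω)
    (ℱ : Filtration ℝ≥0 mΩ) (W : Set OsgoodSPDE.SpaceTime → Ω → ℝ)
    (hW : OsgoodSPDE.IsWhiteNoise P ℱ W) (σ : ℝ)
    (b : ℝ → ℝ) (hb_nonneg : ∀ x, 0 ≤ b x) (hb_cont : Continuous b)
    (hb_mono : MonotoneOn b (Set.Ioi 0))
    (u₀ : unitInterval → ℝ) (hu₀ : MemLp u₀ ∞)
    (u : ℕ → ℝ≥0 → unitInterval → Ω → ℝ)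
    (hu : ∀ N : ℕ, 1 ≤ N →
      OsgoodSPDE.IsGlobalSolution P ℱ W (OsgoodSPDE.truncateDrift b N) σ u₀ (u N))
    (hblowup : 0 < P {ω | OsgoodSPDE.blowupTime u ω < ∞}) :
    OsgoodSPDE.OsgoodCondition b := by
  by_contra hO
  refine hblowup.ne' (measure_eq_zero_iff_ae_notMem.2 ?_)
  filter_upwards [OsgoodSPDE.ae_blowupTime_eq_top hW hb_nonneg hb_cont hb_mono hO hu₀ hu] with ω hω
  exact hω.not_lt

theorem mainTheorem1
    {Ω : Type*} {mΩ : MeasurableSpace Ω} (P : Measure Ω) [IsProbabilityMeasure P]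
    (ℱ : Filtration ℝ≥0 mΩ) (W : Set OsgoodSPDE.SpaceTime → Ω → ℝ)
    (hW : OsgoodSPDE.IsWhiteNoise P ℱ W)
    (σ : ℝ) (hσ : 0 < σ)
    (b : ℝ → ℝ) (hb_nonneg : ∀ x, 0 ≤ b x) (hb_lip : LocallyLipschitz b)
    (hb_mono : MonotoneOn b (Set.Ioi 0))
    (u₀ : unitInterval → ℝ) (hu₀_nonneg : ∀ x, 0 ≤ u₀ x) (hu₀_cont : Continuous u₀)
    (u : ℕ → ℝ≥0 → unitInterval → Ω → ℝ)
    (hu : ∀ N : ℕ, 1 ≤ N →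
      OsgoodSPDE.IsGlobalSolution P ℱ W (OsgoodSPDE.truncateDrift b N) σ u₀ (u N))
    (hblowup : 0 < P {ω | OsgoodSPDE.blowupTime u ω < ∞}) :
    OsgoodSPDE.OsgoodCondition b := by
  exact mainTheorem1_general P ℱ W hW σ b hb_nonneg hb_lip.continuous hb_mono u₀
    (hu₀_cont.memLp_top_of_hasCompactSupport (HasCompactSupport.of_compactSpace u₀) volume) u hu
    hblowup
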